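/- **Setting.** Let $G\subset GL(n,\mathbb R)$ be a closed real semisimple matrix group with Lie algebra $\mathfrak g$, and $G^{\mathbb C}\subset GL(n,\mathbb C)$ a closed subgroup that contains $G$ and has Lie algebra $\mathfrak g^{\mathbb C}=\mathfrak g+i\mathfrak g$. Let $\sigma$ be a holomorphic automorphism of $G^{\mathbb C}$ with $\sigma(G)= G$, $\sigma^k=1$, whose restriction to $G$ has order exactly $k\ge 2$. Put $\zeta=e^{2\pi i/k}$ and let $\mathfrak g_j\subset\mathfrak g^{\mathbb C}$ be the $\zeta^j$-eigenspace of $d\sigma$. Let $K$ be a closed subgroup of $G$ that contains the center of $G$, with $\mathrm{Fix}_\sigma(G)^0\subset K\subset \mathrm{Fix}_\sigma(G)$, and let $K^{\mathbb C}$ be a complexification of $K$: a closed subgroup of $\mathrm{Fix}_\sigma(G^{\mathbb C})$ that contains $\exp(\mathfrak g_0)$ and satisfies $K^{\mathbb C}\cap G=K$ (for $K=\mathrm{Fix}_\sigma(G)$ one may take $K^{\mathbb C}=\mathrm{Fix}_\sigma(G^{\mathbb C})$). Let $\Lambda G^{\mathbb C}_\sigma$ be the set of continuous $\gamma:S^1\to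 G^{\mathbb C}$ with $\sigma(\gamma(\lambda))=\gamma(\zeta\lambda)$, let $\Lambda G_\sigma$ consist of those with values in $G$, and $\Lambda^+G^{\mathbb C}_\sigma$ of those that extend to a continuous $G^{\mathbb C}$-valued map on the closed unit disk, holomorphic inside, with value in $K^{\mathbb C}$ at $\lambda=0$. A smooth map $f:U\to G/K$, $U\subset\mathbb C$ open, is *primitive harmonic* if its local frames $F$ satisfy $F^{-1}dF=(\alpha'_{\mathfrak m}+\alpha'_{\mathfrak k})dz+(\alpha''_{\mathfrak m}+\alpha''_{\mathfrak k})d\bar z$ with $\alpha'_{\mathfrak m}\in\mathfrak g_{-1}$, $\alpha''_{\mathfrak m}\in\mathfrak g_1$, $\alpha'_{\mathfrak k},\alpha''_{\mathfrak k}\in\mathfrak g_0$, and if $$\alpha_\lambda=(\lambda^{-1}\alpha'_{\mathfrak m}+\alpha'_{\mathfrak k})dz+(\lambda\alpha''_{\mathfrak m}+\alpha''_{\mathfrak k})d\bar z$$ satisfies $d\alpha_\lambda+\alpha_\lambda\wedge\alpha_\lambda=0$ for all $\lambda\in S^1$. A map on $\mathbb C/\omega\mathbb Z$ is primitive harmonic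 if its lift to $\mathbb C$ is. A map $f$ on a strip $\mathbb S=\{a<\operatorname{Im}z<b\}$, $-\infty\le a<0<b\le\infty$, is *TE* if $f(z+t)=R(t)f(z)$ for a one-parameter group $R(t)$ in $G$, and *full* if the elements of $G$ that fix all values of $f$ are exactly those of the center of $G$. Let $f:\mathbb S\to G/K$ be a full TE primitive harmonic map, with a quasi-invariant frame $F$ ($F(z+t)=R(t)F(z)$ for $t\in\mathbb R$, $R$ a one-parameter group in $G$, and $F(0)=I$). Let $F_\lambda:\mathbb S\to G$ solve $F_\lambda^{-1}dF_\lambda=\alpha_\lambda$, $F_\lambda(0)=I$; put $f_\lambda=F_\lambda \bmod K$ (the associated family) and $D(\lambda)=\lambda^{-1}\alpha'_{\mathfrak m}(0)+\alpha'_{\mathfrak k}(0)+\alpha''_{\mathfrak k}(0)+\lambda\alpha''_{\mathfrak m}(0)$. Let $\omega\in\mathbb C\setminus\mathbb R$ be such that $\mathbb S\cap(\mathbb S+\omega)\ne\emptyset$ (automatic for $\mathbb S=\mathbb C$). That translation by $\omega$ is a symmetry of $f_\lambda$ means that $f_\lambda$ extends to a primitive harmonic map on $\mathbb C$ with $f_\lambda(z+\omega)=\chi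 f_\lambda(z)$ for all $z\in\mathbb C$ and some $\chi\in G$. **Theorem.** (1) Translation by $\omega$ is a symmetry of $f_\lambda$ for every $\lambda\in S^1$ if and only if there is $b_+\in\Lambda^+G^{\mathbb C}_\sigma$ such that $b_+(\lambda)$ commutes with $D(\lambda)$ for every $\lambda\in S^1$ and $\chi(\lambda)=\exp(\omega D(\lambda))\,b_+(\lambda)^{-1}$ lies in $\Lambda G_\sigma$. (2) If, for such a $b_+$, the element $\chi(\lambda_0)$ is in the center of $G$ for some $\lambda_0\in S^1$, then $\omega$ is a period of $f_{\lambda_0}$, and $f_{\lambda_0}$ descends to a primitive harmonic map $\mathbb C/\omega\mathbb Z\to G/K$ (that is, there is such a map whose lift to $\mathbb C$ restricts to $f_{\lambda_0}$ on $\mathbb S$), which is equivariant under the real translations with respect to a one-parameter group in $G$. -/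

import Mathlib

open scoped ContDiff Matrix

namespace LoopTE

attribute [local instance] LieRing.ofAssociativeRing

/-- Square complex matrices of size `n`. -/
abbrev Mat (n : ℕ) := Matrix (Fin n) (Fin n) ℂ

/-- The inclusion `GL(n, ℝ) → GL(n, ℂ)`. -/
noncomputable def toC (n : ℕ) : GL (Fin n) ℝ →* GL (Fin n) ℂ :=
  Matrix.GeneralLinearGroup.map (algebraMap ℝ ℂ)

/-- The complex matrix underlying an element of `GL(n, ℝ)`. -/
noncomputable def matC {n : ℕ} (g : GL (Fin n) ℝ) : Mat n :=
  ((toC n g : GL (Fin n) ℂ) : Mat n)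

/-- A matrix `A` belongs to the matrix group `H`. -/
def MatMem {n : ℕ} {R : Type} [CommRing R] (H : Subgroup (GL (Fin n) R))
    (A : Matrix (Fin n) (Fin n) R) : Prop :=
  ∃ g ∈ H, (g : Matrix (Fin n) (Fin n) R) = A

/-- The complexification `𝔤 + i𝔤`, inside the complex matrices, of a Lie algebra `𝔤` of real
matrices. -/
noncomputable def complexify {n : ℕ} (g : LieSubalgebra ℝ (Matrix (Fin n) (Fin n) ℝ)) :
    Submodule ℂ (Mat n) :=
  Submodule.span ℂ ((fun X : Matrix (Fin n) (Fin n) ℝ => X.map (algebraMap ℝ ℂ)) '' (g : Set _))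

/-- A `k`-symmetric space `G/K` of a real semisimple matrix group `G`, together with the
complexifications of `G` and `K` that enter the loop group formalism. -/
structure KSymmetricSpace (n k : ℕ) where
  two_le_k : 2 ≤ k
  /-- The real matrix group `G`, a closed subgroup of `GL(n, ℝ)`. -/
  G : Subgroup (GL (Fin n) ℝ)
  isClosed_G : IsClosed (G : Set (GL (Fin n) ℝ))
  /-- The Lie algebra of `G`. -/
  lieG : LieSubalgebra ℝ (Matrix (Fin n) (Fin n) ℝ)
  mem_lieG : ∀ X, X ∈ lieG ↔ ∀ t : ℝ, MatMem G (NormedSpace.exp (t • X))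
  semisimple : LieAlgebra.IsSemisimple ℝ lieG
  /-- The complexified group, a closed subgroup of `GL(n, ℂ)` that contains `G` and has Lie algebra
  `𝔤 + i𝔤`. -/
  GC : Subgroup (GL (Fin n) ℂ)
  isClosed_GC : IsClosed (GC : Set (GL (Fin n) ℂ))
  G_le_GC : ∀ g ∈ G, toC n g ∈ GC
  mem_lieGC : ∀ X, X ∈ complexify lieG ↔ ∀ t : ℝ, MatMem GC (NormedSpace.exp (t • X))
  /-- The automorphism `σ` of `G`, of order `k`, extended to the complexified group. -/
  σ : MulAut GC
  continuous_σ : Continuous σ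
  /-- The differential of `σ`; it is complex linear, that is, `σ` is holomorphic. -/
  dσ : complexify lieG →ₗ[ℂ] complexify lieG
  σ_exp : ∀ (X : complexify lieG) (g : GC),
    ((g : GL (Fin n) ℂ) : Mat n) = NormedSpace.exp (X : Mat n) →
      ((σ g : GL (Fin n) ℂ) : Mat n) = NormedSpace.exp ((dσ X : complexify lieG) : Mat n)
  σ_real : ∀ g : GC, (g : GL (Fin n) ℂ) ∈ G.map (toC n) → (σ g : GL (Fin n) ℂ) ∈ G.map (toC n)
  σ_pow : σ ^ k = 1
  σ_order : ∀ j : ℕ, 0 < j → j < k →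
    ∃ g : GC, (g : GL (Fin n) ℂ) ∈ G.map (toC n) ∧ (σ ^ j) g ≠ g
  /-- The closed subgroup `K` of `G`, with `Fix_σ(G)⁰ ⊆ K ⊆ Fix_σ(G)` and containing the center. -/
  K : Subgroup G
  isClosed_K : IsClosed (K : Set G)
  center_le_K : Subgroup.center G ≤ K
  K_le_fix : ∀ g ∈ K, σ ⟨toC n g, G_le_GC g g.2⟩ = ⟨toC n g, G_le_GC g g.2⟩
  fix_zero_le_K :
    connectedComponentIn {g : G | σ ⟨toC n g, G_le_GC g g.2⟩ = ⟨toC n g, G_le_GC g g.2⟩} 1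
      ⊆ (K : Set G)
  /-- A complexification of `K`: a closed subgroup of `Fix_σ(Gᶜ)` with full Lie algebra
  and real part `K`. -/
  KC : Subgroup GC
  isClosed_KC : IsClosed (KC : Set GC)
  KC_le_fix : ∀ g ∈ KC, σ g = g
  exp_mem_KC : ∀ (X : complexify lieG) (g : GC), dσ X = X →
    ((g : GL (Fin n) ℂ) : Mat n) = NormedSpace.exp (X : Mat n) → g ∈ KC
  mem_K_iff : ∀ g : G, g ∈ K ↔ (⟨toC n g, G_le_GC g g.2⟩ : GC) ∈ KC

namespace KSymmetricSpace

variable {n k : ℕ} (S : KSymmetricSpace n k)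

/-- The homogeneous space `G/K`. -/
abbrev Quot : Type := S.G ⧸ S.K

/-- The inclusion of `G` into its complexification. -/
noncomputable def incl (g : S.G) : S.GC := ⟨toC n g, S.G_le_GC g g.2⟩

/-- The complex matrix of an element of the complexified group. -/
def mat (g : S.GC) : Mat n := ((g : GL (Fin n) ℂ) : Mat n)

/-- The eigenspace `𝔤_j` of `σ` on `𝔤 + i𝔤` for the eigenvalue `exp(2πi/k)^j`. -/
def eigen (j : ℤ) : Set (Mat n) :=
  {X | ∃ h : X ∈ complexify S.lieG,
    (S.dσ ⟨X, h⟩ : Mat n) = (Complex.exp (2 * Real.pi * Complex.I / k)) ^ j • X}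

end KSymmetricSpace

/-! The norm on matrices is only used to speak of derivatives. -/

attribute [local instance] Matrix.linftyOpNormedAddCommGroup Matrix.linftyOpNormedSpace

/-! Loop groups -/

/-- `exp(2πi/k)` as a point of the circle. -/
noncomputable def zeta (k : ℕ) : Circle := Circle.exp (2 * Real.pi / k)

/-- The twisted loop group `ΛGᶜ_σ`. -/
def LoopC {n k : ℕ} (S : KSymmetricSpace n k) : Set (Circle → S.GC) :=
  {γ | Continuous γ ∧ ∀ l : Circle, S.σ (γ l) = γ (zeta k * l)}

/-- The real twisted loop group `ΛG_σ`. -/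
def LoopReal {n k : ℕ} (S : KSymmetricSpace n k) : Set (Circle → S.GC) :=
  {γ | γ ∈ LoopC S ∧ ∀ l : Circle, ∃ g : S.G, S.incl g = γ l}

/-- The group `Λ⁺Gᶜ_σ` of twisted loops that extend holomorphically to the unit disk, with value in
the complexification of `K` at the origin. -/
def LoopPlus {n k : ℕ} (S : KSymmetricSpace n k) : Set (Circle → S.GC) :=
  {γ | γ ∈ LoopC S ∧ ∃ Γ : ℂ → S.GC,
    DiffContOnCl ℂ (fun l => S.mat (Γ l)) (Metric.ball 0 1) ∧
    Γ 0 ∈ S.KC ∧ ∀ l : Circle, Γ (l : ℂ) = γ l}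

/-! Maurer-Cartan forms -/

/-- `∂_z F = (∂_u F - i ∂_v F) / 2`, where `z = u + i v`. -/
noncomputable def dz {n : ℕ} (F : ℂ → Mat n) (z : ℂ) : Mat n :=
  (1 / 2 : ℂ) • (fderiv ℝ F z 1 - Complex.I • fderiv ℝ F z Complex.I)

/-- `∂_z̄ F = (∂_u F + i ∂_v F) / 2`, where `z = u + i v`. -/
noncomputable def dzbar {n : ℕ} (F : ℂ → Mat n) (z : ℂ) : Mat n :=
  (1 / 2 : ℂ) • (fderiv ℝ F z 1 + Complex.I • fderiv ℝ F z Complex.I)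

/-- The coefficients of a matrix valued one-form
`(α'_𝔪 + α'_𝔨) dz + (α''_𝔪 + α''_𝔨) dz̄`. -/
structure Form (n : ℕ) where
  m' : ℂ → Mat n
  k' : ℂ → Mat n
  m'' : ℂ → Mat n
  k'' : ℂ → Mat n

namespace Form

variable {n k : ℕ}

/-- The `dz`-coefficient `λ⁻¹ α'_𝔪 + α'_𝔨` of `α_λ`. -/
noncomputable def coeffDz (α : Form n) (l : Circle) (z : ℂ) : Mat n :=
  (l : ℂ)⁻¹ • α.m' z + α.k' z

/-- The `dz̄`-coefficient `λ α''_𝔪 + α''_𝔨` of `α_λ`. -/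
noncomputable def coeffDzbar (α : Form n) (l : Circle) (z : ℂ) : Mat n :=
  (l : ℂ) • α.m'' z + α.k'' z

/-- `F⁻¹ dF = α_λ` on `U`, written without the inverse. -/
def IsSolution (α : Form n) (l : Circle) (U : Set ℂ) (F : ℂ → Mat n) : Prop :=
  ∀ z ∈ U, dz F z = F z * α.coeffDz l z ∧ dzbar F z = F z * α.coeffDzbar l z

/-- `α = α₋₁ + α₀ + α₁` with `α'_𝔪 ∈ 𝔤₋₁` and `α''_𝔪 ∈ 𝔤₁`, and `α_λ` is integrable, that is
`dα_λ + α_λ ∧ α_λ = 0`, for every `λ` in the unit circle. -/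
def IsPrimitive (S : KSymmetricSpace n k) (U : Set ℂ) (α : Form n) : Prop :=
  (∀ z ∈ U, α.m' z ∈ S.eigen (-1) ∧ α.k' z ∈ S.eigen 0 ∧
    α.m'' z ∈ S.eigen 1 ∧ α.k'' z ∈ S.eigen 0) ∧
  ∀ l : Circle, ∀ z ∈ U,
    dz (α.coeffDzbar l) z - dzbar (α.coeffDz l) z
      + (α.coeffDz l z * α.coeffDzbar l z - α.coeffDzbar l z * α.coeffDz l z) = 0

/-- `D(λ) = λ⁻¹ α'_𝔪(0) + α'_𝔨(0) + α''_𝔨(0) + λ α''_𝔪(0)`. -/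
noncomputable def delaunay (α : Form n) (l : Circle) : Mat n :=
  α.coeffDz l 0 + α.coeffDzbar l 0

end Form

/-! Maps into `G/K` -/

section Maps

variable {n k : ℕ} (S : KSymmetricSpace n k)

/-- `F` is a smooth frame of `f` on `U`. -/
def IsFrame (U : Set ℂ) (f : ℂ → S.Quot) (F : ℂ → S.G) : Prop :=
  ContDiffOn ℝ ∞ (fun z => matC (F z : GL (Fin n) ℝ)) U ∧
  ∀ z ∈ U, (QuotientGroup.mk (F z) : S.Quot) = f z

/-- `f` is smooth and primitive harmonic on the open set `U`: around each point there is a smooth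
frame whose Maurer-Cartan form is primitive with `α_λ` integrable for all `λ` in the circle. -/
def IsPrimitiveHarmonicOn (U : Set ℂ) (f : ℂ → S.Quot) : Prop :=
  ∀ z₀ ∈ U, ∃ V : Set ℂ, IsOpen V ∧ z₀ ∈ V ∧ V ⊆ U ∧
    ∃ (F : ℂ → S.G) (α : Form n), IsFrame S V f F ∧ α.IsPrimitive S V ∧
      α.IsSolution 1 V (fun z => matC (F z : GL (Fin n) ℝ))

/-- The open strip `a < Im z < b`. -/
def strip (a b : EReal) : Set ℂ := {z | a < (z.im : EReal) ∧ (z.im : EReal) < b}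

/-- `f` is full on `U`: the elements of `G` that fix each value of `f` form the center of `G`. -/
def IsFull (U : Set ℂ) (f : ℂ → S.Quot) : Prop :=
  {R : S.G | ∀ z ∈ U, R • f z = f z} = (Subgroup.center S.G : Set S.G)

/-- A (continuous) one-parameter group in `G`. -/
def IsOneParameterGroup (R : ℝ → S.G) : Prop :=
  Continuous R ∧ ∀ s t : ℝ, R (s + t) = R s * R t

/-- `f` is translationally equivariant on the strip `U`. -/
def IsTE (U : Set ℂ) (f : ℂ → S.Quot) : Prop :=
  ∃ R : ℝ → S.G, IsOneParameterGroup S R ∧ ∀ z ∈ U, ∀ t : ℝ, f (z + t) = R t • f z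

/-- `fam` is the associated family of `f` on `U`, and `D` is its Delaunay potential. Here `F` is a
quasi-invariant frame of `f` with `F(0) = I`, `α` is its Maurer-Cartan form, and `E` is the
extended frame, that is, the solution of `E_λ⁻¹ dE_λ = α_λ`, `E_λ(0) = I`. -/
def IsAssociatedFamily (U : Set ℂ) (f : ℂ → S.Quot) (fam : Circle → ℂ → S.Quot)
    (D : Circle → Mat n) : Prop :=
  ∃ (F : ℂ → S.G) (α : Form n) (E : Circle → ℂ → S.G),
    (IsFrame S U f F ∧ F 0 = 1 ∧
      ∃ R : ℝ → S.G, IsOneParameterGroup S R ∧ ∀ z ∈ U, ∀ t : ℝ, F (z + t) = R t * F z) ∧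
    (α.IsPrimitive S U ∧ α.IsSolution 1 U (fun z => matC (F z : GL (Fin n) ℝ))) ∧
    (∀ l : Circle, ContDiffOn ℝ ∞ (fun z => matC (E l z : GL (Fin n) ℝ)) U ∧
      α.IsSolution l U (fun z => matC (E l z : GL (Fin n) ℝ)) ∧ E l 0 = 1) ∧
    (∀ l : Circle, ∀ z ∈ U, fam l z = QuotientGroup.mk (E l z)) ∧
    (∀ l : Circle, D l = α.delaunay l)

/-- The translation by `w` is a symmetry of the map `f` given on `U`: `f` extends to a primitive
harmonic map on `ℂ` that satisfies `f(z + w) = χ f(z)` for some `χ` in `G`. -/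
def AdmitsTranslation (U : Set ℂ) (f : ℂ → S.Quot) (w : ℂ) : Prop :=
  ∃ g : ℂ → S.Quot, Set.EqOn g f U ∧ IsPrimitiveHarmonicOn S Set.univ g ∧
    ∃ χ : S.G, ∀ z : ℂ, g (z + w) = χ • g z

/-- `b ∈ Λ⁺Gᶜ_σ` commutes with `D`, and `χ = exp(w D) b⁻¹` lies in `ΛG_σ`. -/
def IsMonodromyPair (D : Circle → Mat n) (w : ℂ) (b χ : Circle → S.GC) : Prop :=
  b ∈ LoopPlus S ∧ (∀ l : Circle, Commute (S.mat (b l)) (D l)) ∧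
  χ ∈ LoopReal S ∧ ∀ l : Circle, S.mat (χ l) = NormedSpace.exp (w • D l) * S.mat (b l)⁻¹

/-- The cylinder `ℂ / wℤ`. -/
abbrev Cylinder (w : ℂ) : Type := ℂ ⧸ AddSubgroup.zmultiples w

/-- A map on the cylinder is primitive harmonic if its lift to `ℂ` is; the projection is a local
biholomorphism, and primitive harmonicity is local. -/
def IsPrimitiveHarmonicCylinder (w : ℂ) (g : Cylinder w → S.Quot) : Prop :=
  IsPrimitiveHarmonicOn S Set.univ (fun z : ℂ => g (QuotientAddGroup.mk z))

end Maps

end LoopTE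

/-!
Write `E l` for the extended frame of the associated family with loop parameter `l`, so that
`fam l = E l mod K` and `E l (z + t) = exp (t D(l)) E l z` for real `t`.

**Factorization.** On the strip, `E l z = exp (z D(l)) V_z(l)` with the loop `V_z` in `Λ⁺`
(`exists_factorization`): along the segment from `0` to `z` the factor `V_z` solves a linear
equation, and the invariance under real translations, `D(l) E l = E l α_l(∂/∂x)`, cancels the
`l⁻¹`-part of its coefficients.  Hence its Euler product approximations are entire in `l`; they
converge uniformly on the circle (`tendstoUniformly_eulerProd`), so by the maximum principle also on
the disk, and the limit extends holomorphically (`extendsToDisc_of_tendstoUniformly`).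

**From the loop to the symmetry.** If `χ = exp (w D) b⁻¹` takes values in `G`, then
`(χ E z)⁻¹ E (z + w) = V_z⁻¹ b V_{z+w}` is both in `Λ⁺` and in `ΛG`.  A loop that extends to the disk
and is real on the circle is constant (`eq_const_of_real`), with value in `K`.  Thus
`fam l (z + w) = χ(l) fam l z` wherever both sides make sense, and gluing the translates of the strip
by the multiples of `w` extends `fam l` to `ℂ` (`exists_extension`).

**From the symmetry to the loop.** The symmetry for `l = 1` is enough.  It makes
`κ z = (χ E_1 z)⁻¹ E_1 (z + w)` a gauge between two frames with values in `K`.  As `σ` fixes `κ`, the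
same `κ` is a gauge for every `l`, so that `E l (z + w) = χ(l) E l z κ z` for a loop `χ` in `ΛG_σ`
(`exists_loop_of_gauge`).  For real `t` the commutator of `χ(1)` with the one-parameter group of `f`
fixes the values of `f` on the overlap of the strip with its translate, and therefore everywhere
(`conj_mem_K_of_open`); by fullness it is central.  In a semisimple group a one-parameter group
whose commutators with a fixed element are central commutes with that element
(`commute_of_commutator_mem_center`).  Hence `χ` commutes with `D`, and
`b = χ⁻¹ exp (w D) = V_z κ V_{z+w}⁻¹` is in `Λ⁺` (`exists_isMonodromyPair`).

**Periods.** A central value `χ(l₀)` lies in `K` and acts trivially on `G/K`, so the extension of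
`fam l₀` is `w`-periodic and descends to the cylinder.
-/

namespace LoopTE

open Filter Topology NormedSpace

/-! ### Product integrals in a Banach algebra -/

section Euler

-- The hypothesis `‖1‖ ≤ 1`, instead of `‖1‖ = 1`, admits the matrix algebra of size zero.
variable {𝔸 : Type*} [NormedRing 𝔸] [NormedAlgebra ℝ 𝔸]

theorem norm_exp_le_of_norm_one_le (h1 : ‖(1 : 𝔸)‖ ≤ 1) (x : 𝔸) :
    ‖exp x‖ ≤ Real.exp ‖x‖ := by
  have hle : ∀ m : ℕ, ‖((m.factorial : ℝ)⁻¹ • x ^ m : 𝔸)‖ ≤ (m.factorial : ℝ)⁻¹ • ‖x‖ ^ m := by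
    intro m
    rw [norm_smul, Real.norm_of_nonneg (by positivity), smul_eq_mul]
    refine mul_le_mul_of_nonneg_left ?_ (by positivity)
    rcases m with _ | m
    · simpa using h1
    · exact norm_pow_le' x m.succ_pos
  rw [exp_eq_tsum ℝ, Real.exp_eq_exp_ℝ, exp_eq_tsum ℝ]
  exact tsum_of_norm_bounded (expSeries_summable' (𝕂 := ℝ) ‖x‖).hasSum hle

/-- Gronwall bound for the solution of `Y' = Y B`, `Y 0 = 1`. -/
theorem norm_le_exp_of_hasDerivAt (h1 : ‖(1 : 𝔸)‖ ≤ 1) {B Y : ℝ → 𝔸} {M : ℝ}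
    (hY : ∀ s ∈ Set.Icc (0 : ℝ) 1, HasDerivAt Y (Y s * B s) s) (hY0 : Y 0 = 1)
    (hM : ∀ s ∈ Set.Icc (0 : ℝ) 1, ‖B s‖ ≤ M) {s : ℝ} (hs : s ∈ Set.Icc (0 : ℝ) 1) :
    ‖Y s‖ ≤ Real.exp M := by
  have hM0 : 0 ≤ M := (norm_nonneg _).trans (hM 0 (by simp))
  have := norm_le_gronwallBound_of_norm_deriv_right_le (f := Y) (f' := fun s => Y s * B s)
    (δ := 1) (K := M) (ε := 0) (a := 0) (b := 1)
    (fun s hs => (hY s hs).continuousAt.continuousWithinAt)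
    (fun s hs => (hY s ⟨hs.1, hs.2.le⟩).hasDerivWithinAt) (by rwa [hY0])
    (fun s hs => by
      rw [add_zero, mul_comm M]
      exact (norm_mul_le _ _).trans
        (mul_le_mul_of_nonneg_left (hM s ⟨hs.1, hs.2.le⟩) (norm_nonneg _))) s hs
  rw [gronwallBound_ε0, one_mul, sub_zero] at this
  exact this.trans (Real.exp_le_exp.2 (mul_le_of_le_one_right hM0 hs.2))

/-- The Euler product `∏_{j < i} exp (B (j / N) / N)`, factors in increasing order, which
approximates the solution of `Y' = Y B`, `Y 0 = 1` at the point `i / N`. -/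
noncomputable def eulerProd (B : ℝ → 𝔸) (N : ℕ) : ℕ → 𝔸
  | 0 => 1
  | i + 1 => eulerProd B N i * exp ((1 / N : ℝ) • B (i / N))

/-- The inverse of `eulerProd`. -/
noncomputable def eulerProdInv (B : ℝ → 𝔸) (N : ℕ) : ℕ → 𝔸
  | 0 => 1
  | i + 1 => exp (-((1 / N : ℝ) • B (i / N))) * eulerProdInv B N i

theorem norm_eulerProd_le (h1 : ‖(1 : 𝔸)‖ ≤ 1) {B : ℝ → 𝔸} {M : ℝ}
    (hM : ∀ s ∈ Set.Icc (0 : ℝ) 1, ‖B s‖ ≤ M) {N i : ℕ} (hi : i ≤ N) :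
    ‖eulerProd B N i‖ ≤ Real.exp (i / N * M) ∧ ‖eulerProdInv B N i‖ ≤ Real.exp (i / N * M) := by
  induction i with
  | zero => simp [eulerProd, eulerProdInv, h1]
  | succ i ih =>
    have hN : (0 : ℝ) < N := by exact_mod_cast (Nat.succ_pos i).trans_le hi
    have hmem : (i / N : ℝ) ∈ Set.Icc (0 : ℝ) 1 :=
      ⟨by positivity, by rw [div_le_one hN]; exact_mod_cast (Nat.le_succ i).trans hi⟩
    have hb : ‖(1 / N : ℝ) • B (i / N)‖ ≤ 1 / N * M := by
      rw [norm_smul, Real.norm_of_nonneg (by positivity)]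
      exact mul_le_mul_of_nonneg_left (hM _ hmem) (by positivity)
    have he : ((i + 1 : ℕ) / N * M : ℝ) = i / N * M + 1 / N * M := by push_cast; ring
    obtain ⟨ih1, ih2⟩ := ih ((Nat.le_succ i).trans hi)
    rw [he, Real.exp_add]
    constructor
    · refine (norm_mul_le _ _).trans (mul_le_mul ih1 ?_ (norm_nonneg _) (Real.exp_pos _).le)
      exact (norm_exp_le_of_norm_one_le h1 _).trans (Real.exp_le_exp.2 hb)
    · refine (norm_mul_le _ _).trans ?_
      rw [mul_comm]
      refine mul_le_mul ih2 ?_ (norm_nonneg _) (Real.exp_pos _).le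
      exact (norm_exp_le_of_norm_one_le h1 _).trans (Real.exp_le_exp.2 (by rwa [norm_neg]))

theorem norm_eulerProd_self_le (h1 : ‖(1 : 𝔸)‖ ≤ 1) {B : ℝ → 𝔸} {M : ℝ}
    (hM : ∀ s ∈ Set.Icc (0 : ℝ) 1, ‖B s‖ ≤ M) {N i : ℕ} (hi : i ≤ N) :
    ‖eulerProd B N i‖ ≤ Real.exp M ∧ ‖eulerProdInv B N i‖ ≤ Real.exp M := by
  have hM0 : 0 ≤ M := (norm_nonneg _).trans (hM 0 (by simp))
  have : (i / N * M : ℝ) ≤ M :=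
    mul_le_of_le_one_left hM0 (div_le_one_of_le₀ (by exact_mod_cast hi) (by positivity))
  obtain ⟨h, h'⟩ := norm_eulerProd_le h1 hM hi
  exact ⟨h.trans (Real.exp_le_exp.2 this), h'.trans (Real.exp_le_exp.2 this)⟩

variable [CompleteSpace 𝔸]

theorem exp_mul_exp_neg (x : 𝔸) : exp x * exp (-x) = 1 := by
  let _ : NormedAlgebra ℚ 𝔸 := .restrictScalars ℚ ℝ 𝔸
  rw [← exp_add_of_commute ((Commute.refl x).neg_right), add_neg_cancel, exp_zero]

theorem exp_neg_mul_exp (x : 𝔸) : exp (-x) * exp x = 1 := by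
  simpa using exp_mul_exp_neg (-x)

theorem eulerProd_mul_inv (B : ℝ → 𝔸) (N i : ℕ) : eulerProd B N i * eulerProdInv B N i = 1 := by
  induction i with
  | zero => simp [eulerProd, eulerProdInv]
  | succ i ih =>
    rw [eulerProd, eulerProdInv, mul_assoc, ← mul_assoc (exp _), exp_mul_exp_neg, one_mul, ih]

theorem eulerProdInv_mul (B : ℝ → 𝔸) (N i : ℕ) : eulerProdInv B N i * eulerProd B N i = 1 := by
  induction i with
  | zero => simp [eulerProd, eulerProdInv]
  | succ i ih =>
    rw [eulerProd, eulerProdInv, mul_assoc, ← mul_assoc (eulerProdInv B N i), ih, one_mul,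
      exp_neg_mul_exp]

/-- The error of the Euler product is controlled by the oscillation `ε` of `B` on intervals of
length `1 / N` and a bound `M` of `B`. The quantity that stays nearly constant is
`Y (i / N) * (eulerProd B N i)⁻¹`. -/
theorem norm_sub_eulerProd_le (h1 : ‖(1 : 𝔸)‖ ≤ 1) {B Y : ℝ → 𝔸} {M ε : ℝ}
    (hY : ∀ s ∈ Set.Icc (0 : ℝ) 1, HasDerivAt Y (Y s * B s) s) (hY0 : Y 0 = 1)
    (hM : ∀ s ∈ Set.Icc (0 : ℝ) 1, ‖B s‖ ≤ M) {N : ℕ} (hN : 0 < N)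
    (hε : ∀ s ∈ Set.Icc (0 : ℝ) 1, ∀ t ∈ Set.Icc (0 : ℝ) 1, |s - t| ≤ 1 / N → ‖B s - B t‖ ≤ ε) :
    ‖Y 1 - eulerProd B N N‖ ≤ ε * Real.exp (4 * M) := by
  have hM0 : 0 ≤ M := (norm_nonneg _).trans (hM 0 (by simp))
  have hε0 : 0 ≤ ε := (norm_nonneg _).trans (hε 0 (by simp) 0 (by simp) (by simp))
  have hN' : (0 : ℝ) < N := by exact_mod_cast hN
  have key : ∀ i : ℕ, i ≤ N →
      ‖Y (i / N) * eulerProdInv B N i - 1‖ ≤ i / N * (ε * Real.exp (3 * M)) := by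
    intro i
    induction i with
    | zero => intro _; simp [eulerProdInv, hY0]
    | succ i ih =>
      intro hi
      have hi' : i ≤ N := (Nat.le_succ i).trans hi
      have hii : ((i + 1 : ℕ) / N : ℝ) = i / N + 1 / N := by push_cast; ring
      have hle1 : (i / N + 1 / N : ℝ) ≤ 1 := by
        rw [← hii, div_le_one hN']; exact_mod_cast hi
      have h0i : (0 : ℝ) ≤ i / N := by positivity
      have hmem : ∀ s ∈ Set.Icc (i / N : ℝ) (i / N + 1 / N), s ∈ Set.Icc (0 : ℝ) 1 :=
        fun s hs => ⟨h0i.trans hs.1, hs.2.trans hle1⟩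
      have hmi : (i / N : ℝ) ∈ Set.Icc (0 : ℝ) 1 := hmem _ ⟨le_rfl, by simp⟩
      set b := B (i / N) with hb
      let Z : ℝ → 𝔸 := fun s => Y s * exp ((s - i / N) • (-b))
      have hZ : ∀ s ∈ Set.Icc (i / N : ℝ) (i / N + 1 / N),
          HasDerivWithinAt Z (Y s * (B s - b) * exp ((s - i / N) • (-b)))
            (Set.Icc (i / N : ℝ) (i / N + 1 / N)) s := by
        intro s hs
        have h2 : HasDerivAt (fun s : ℝ => exp ((s - i / N) • (-b)))
            (-b * exp ((s - i / N) • (-b))) s := by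
          simpa using (hasDerivAt_exp_smul_const' (-b) (s - i / N : ℝ)).comp_sub_const s (i / N : ℝ)
        have := (hY s (hmem s hs)).mul h2
        refine (this.congr_deriv ?_).hasDerivWithinAt
        noncomm_ring
      have hZb : ∀ s ∈ Set.Ico (i / N : ℝ) (i / N + 1 / N),
          ‖Y s * (B s - b) * exp ((s - i / N) • (-b))‖ ≤ Real.exp M * ε * Real.exp M := by
        intro s hs
        have hs' : s ∈ Set.Icc (i / N : ℝ) (i / N + 1 / N) := ⟨hs.1, hs.2.le⟩
        have hd : |s - i / N| ≤ 1 / N := by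
          rw [abs_of_nonneg (sub_nonneg.2 hs.1)]; linarith [hs.2]
        have hd1 : |s - i / N| ≤ 1 := by
          rw [abs_of_nonneg (sub_nonneg.2 hs.1)]; linarith [hs.2]
        refine (norm_mul_le _ _).trans (mul_le_mul ((norm_mul_le _ _).trans (mul_le_mul ?_ ?_
          (norm_nonneg _) (Real.exp_pos _).le)) ?_ (norm_nonneg _) (by positivity))
        · exact norm_le_exp_of_hasDerivAt h1 hY hY0 hM (hmem s hs')
        · exact hε s (hmem s hs') _ hmi hd
        · refine (norm_exp_le_of_norm_one_le h1 _).trans (Real.exp_le_exp.2 ?_)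
          rw [norm_smul, norm_neg, Real.norm_eq_abs]
          exact (mul_le_mul hd1 (hM _ hmi) (norm_nonneg _) zero_le_one).trans_eq (one_mul M)
      have hdiff := norm_image_sub_le_of_norm_deriv_le_segment' hZ hZb (i / N + 1 / N)
        ⟨by simp, le_rfl⟩
      have hZ0 : Z (i / N) = Y (i / N) := by simp [Z]
      have hZ1 : Z (i / N + 1 / N) = Y (i / N + 1 / N) * exp (-((1 / N : ℝ) • b)) := by
        simp [Z]
      have hstep : Y ((i + 1 : ℕ) / N) * eulerProdInv B N (i + 1) - 1
          = (Z (i / N + 1 / N) - Z (i / N)) * eulerProdInv B N i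
            + (Y (i / N) * eulerProdInv B N i - 1) := by
        rw [hZ0, hZ1, hii, eulerProdInv]
        noncomm_ring
      rw [hstep]
      refine (norm_add_le _ _).trans ?_
      have h3 : ‖(Z (i / N + 1 / N) - Z (i / N)) * eulerProdInv B N i‖
          ≤ 1 / N * (ε * Real.exp (3 * M)) := by
        refine (norm_mul_le _ _).trans ((mul_le_mul hdiff (norm_eulerProd_self_le h1 hM hi').2
          (norm_nonneg _) (mul_nonneg (by positivity) (by simp))).trans_eq ?_)
        rw [show 3 * M = M + M + M by ring, Real.exp_add, Real.exp_add]
        ring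
      calc _ ≤ 1 / N * (ε * Real.exp (3 * M)) + i / N * (ε * Real.exp (3 * M)) :=
            add_le_add h3 (ih hi')
        _ = _ := by rw [hii]; ring
  have h := key N le_rfl
  rw [div_self hN'.ne', one_mul] at h
  have hfac : Y 1 - eulerProd B N N = (Y 1 * eulerProdInv B N N - 1) * eulerProd B N N := by
    rw [sub_mul, one_mul, mul_assoc, eulerProdInv_mul, mul_one]
  rw [hfac]
  refine (norm_mul_le _ _).trans ((mul_le_mul h (norm_eulerProd_self_le h1 hM le_rfl).1
    (norm_nonneg _) (by positivity)).trans_eq ?_)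
  rw [mul_assoc, ← Real.exp_add]
  ring_nf

/-- The Euler products of a family `B l`, bounded and equicontinuous uniformly in `l`, converge to
the solutions of `Y' = Y B`, `Y 0 = 1` uniformly in `l`. -/
theorem tendstoUniformly_eulerProd (h1 : ‖(1 : 𝔸)‖ ≤ 1) {Λ : Type*} {B Y : Λ → ℝ → 𝔸} {M : ℝ}
    (hY : ∀ l, ∀ s ∈ Set.Icc (0 : ℝ) 1, HasDerivAt (Y l) (Y l s * B l s) s)
    (hY0 : ∀ l, Y l 0 = 1)
    (hM : ∀ l, ∀ s ∈ Set.Icc (0 : ℝ) 1, ‖B l s‖ ≤ M)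
    (hB : ∀ ε > 0, ∃ δ > 0, ∀ l, ∀ s ∈ Set.Icc (0 : ℝ) 1, ∀ t ∈ Set.Icc (0 : ℝ) 1,
      |s - t| < δ → ‖B l s - B l t‖ ≤ ε) :
    TendstoUniformly (fun N l => eulerProd (B l) N N) (fun l => Y l 1) atTop := by
  rw [Metric.tendstoUniformly_iff]
  intro ε hε
  obtain ⟨δ, hδ, h⟩ := hB (ε / 2 / Real.exp (4 * M)) (by positivity)
  have hlim := tendsto_one_div_atTop_nhds_zero_nat (𝕜 := ℝ)
  filter_upwards [hlim.eventually (gt_mem_nhds hδ), eventually_gt_atTop 0] with N hN hN0 l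
  rw [dist_eq_norm]
  refine (norm_sub_eulerProd_le h1 (hY l) (hY0 l) (hM l) hN0
    (fun s hs t ht hst => h l s hs t ht (hst.trans_lt hN))).trans_lt ?_
  rw [div_mul_cancel₀ _ (Real.exp_pos _).ne']
  linarith

end Euler

/-! ### Functions on the circle that extend to the disk -/

section Disc

variable {E : Type*} [NormedAddCommGroup E] [NormedSpace ℂ E]

/-- A function on the circle is the boundary value of a continuous function on the closed unit disk
that is holomorphic inside. -/
def HasDiscExtension (h : Circle → E) : Prop :=
  ∃ Γ : ℂ → E, DiffContOnCl ℂ Γ (Metric.ball 0 1) ∧ ∀ l : Circle, Γ l = h l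

theorem norm_le_of_norm_circle_le {Γ : ℂ → E} (hΓ : DiffContOnCl ℂ Γ (Metric.ball 0 1)) {C : ℝ}
    (hC : ∀ l : Circle, ‖Γ l‖ ≤ C) {z : ℂ} (hz : z ∈ Metric.closedBall (0 : ℂ) 1) : ‖Γ z‖ ≤ C := by
  refine Complex.norm_le_of_forall_mem_frontier_norm_le Metric.isBounded_ball hΓ (fun w hw => ?_)
    (by rwa [closure_ball _ one_ne_zero])
  rw [frontier_ball _ one_ne_zero] at hw
  exact hC ⟨w, by simpa [Submonoid.unitSphere] using hw⟩

/-- By the maximum principle, uniform convergence on the circle propagates to the disk. -/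
theorem exists_tendstoUniformlyOn_disc [CompleteSpace E] {Γ : ℕ → ℂ → E} {h : Circle → E}
    (hΓ : ∀ N, DiffContOnCl ℂ (Γ N) (Metric.ball 0 1))
    (hlim : TendstoUniformly (fun N (l : Circle) => Γ N l) h atTop) :
    ∃ L : ℂ → E, DiffContOnCl ℂ L (Metric.ball 0 1) ∧ (∀ l : Circle, L l = h l) ∧
      TendstoUniformlyOn Γ L atTop (Metric.closedBall 0 1) := by
  have hcau : UniformCauchySeqOn Γ atTop (Metric.closedBall 0 1) := by
    rw [Metric.uniformCauchySeqOn_iff]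
    intro ε hε
    have h1 := (tendstoUniformlyOn_univ.2 hlim).uniformCauchySeqOn
    rw [Metric.uniformCauchySeqOn_iff] at h1
    obtain ⟨N, hN⟩ := h1 (ε / 2) (by positivity)
    refine ⟨N, fun m hm p hp z hz => ?_⟩
    rw [dist_eq_norm]
    refine (norm_le_of_norm_circle_le ((hΓ m).sub (hΓ p)) (C := ε / 2) (fun l => ?_) hz).trans_lt
      (by linarith)
    have := hN m hm p hp l (Set.mem_univ _)
    rw [dist_eq_norm] at this
    exact this.le
  choose! L hL using fun z (hz : z ∈ Metric.closedBall (0 : ℂ) 1) =>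
    cauchySeq_tendsto_of_complete (hcau.cauchySeq hz)
  have hunif := hcau.tendstoUniformlyOn_of_tendsto hL
  refine ⟨L, ⟨?_, ?_⟩, fun l => ?_, hunif⟩
  · exact (hunif.mono Metric.ball_subset_closedBall).tendstoLocallyUniformlyOn.differentiableOn
      (Eventually.of_forall fun N => (hΓ N).differentiableOn) Metric.isOpen_ball
  · rw [closure_ball _ one_ne_zero]
    exact hunif.continuousOn (Frequently.of_forall fun N => by
      simpa [closure_ball (0 : ℂ) one_ne_zero] using (hΓ N).continuousOn)
  · exact tendsto_nhds_unique (hL l (by simp [Circle.norm_coe])) (hlim.tendsto_at l)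

/-- A holomorphic function on the disk that is real on the circle is constant. -/
theorem eq_of_real_on_circle {f : ℂ → ℂ} (hf : DiffContOnCl ℂ f (Metric.ball 0 1))
    (hr : ∀ l : Circle, (f l).im = 0) {z : ℂ} (hz : z ∈ Metric.closedBall (0 : ℂ) 1) :
    f z = f 0 := by
  -- The maximum principle for `exp (± i f)` shows that `f` is real on the whole disk.
  have him : ∀ w ∈ Metric.closedBall (0 : ℂ) 1, (f w).im = 0 := by
    intro w hw
    have h1 : ∀ a : ℂ, DiffContOnCl ℂ (fun z => Complex.exp (a * f z)) (Metric.ball 0 1) := fun a =>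
      Complex.differentiable_exp.comp_diffContOnCl (hf.const_smul a)
    have h2 := norm_le_of_norm_circle_le (h1 Complex.I) (C := 1)
      (fun l => by simp [Complex.norm_exp, hr l]) hw
    have h3 := norm_le_of_norm_circle_le (h1 (-Complex.I)) (C := 1)
      (fun l => by simp [Complex.norm_exp, hr l]) hw
    simp only [Complex.norm_exp, Real.exp_le_one_iff] at h2 h3
    simp at h2 h3
    linarith
  -- Then `exp (-(f - f 0) ^ 2)` attains its maximal modulus at the center.
  have h0 : (0 : ℂ) ∈ Metric.closedBall (0 : ℂ) 1 := by simp
  have hsq : ∀ w ∈ Metric.closedBall (0 : ℂ) 1,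
      ‖Complex.exp (-(f w - f 0) ^ 2)‖ = Real.exp (-((f w).re - (f 0).re) ^ 2) := by
    intro w hw
    rw [Complex.norm_exp]
    congr 1
    simp [sq, him w hw, him 0 h0]
  have hd : DiffContOnCl ℂ (fun w => Complex.exp (-(f w - f 0) ^ 2)) (Metric.ball 0 1) := by
    have h1 : DiffContOnCl ℂ (fun w => f w - f 0) (Metric.ball 0 1) := hf.sub_const _
    have h2 : Differentiable ℂ (fun u : ℂ => Complex.exp (-u ^ 2)) := by fun_prop
    exact h2.comp_diffContOnCl h1
  have hmax : IsMaxOn (norm ∘ fun w => Complex.exp (-(f w - f 0) ^ 2)) (Metric.ball 0 1) 0 := by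
    intro w hw
    have hw' := Metric.ball_subset_closedBall hw
    simp only [Function.comp, Set.mem_ofPred_eq, hsq w hw', hsq 0 h0]
    simp [sq_nonneg]
  have := Complex.norm_eqOn_closedBall_of_isMaxOn hd hmax hz
  simp only [Function.comp, Function.const, hsq z hz, hsq 0 h0] at this
  simp at this
  apply Complex.ext
  · linarith
  · rw [him z hz, him 0 h0]

end Disc

section Continuation

variable {𝔸 : Type*} [NormedRing 𝔸] [NormedAlgebra ℂ 𝔸]

theorem HasDiscExtension.mul {g h : Circle → 𝔸} (hg : HasDiscExtension g)
    (hh : HasDiscExtension h) : HasDiscExtension fun l => g l * h l := by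
  obtain ⟨Γ, hΓ, hΓg⟩ := hg
  obtain ⟨Δ, hΔ, hΔh⟩ := hh
  exact ⟨fun z => Γ z * Δ z, ⟨hΓ.differentiableOn.mul hΔ.differentiableOn,
    hΓ.continuousOn.mul hΔ.continuousOn⟩, fun l => by simp only [hΓg, hΔh]⟩

/-- The continuous functions on the circle that extend to the disk. -/
def discSubmodule (𝔸 : Type*) [NormedRing 𝔸] [NormedAlgebra ℂ 𝔸] : Submodule ℂ C(Circle, 𝔸) where
  carrier := {h | HasDiscExtension h}
  add_mem' := by
    rintro g h ⟨Γ, hΓ, hΓg⟩ ⟨Δ, hΔ, hΔh⟩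
    exact ⟨Γ + Δ, hΓ.add hΔ, fun l => by simp [hΓg, hΔh]⟩
  zero_mem' := ⟨0, diffContOnCl_const, fun _ => rfl⟩
  smul_mem' := by
    rintro c g ⟨Γ, hΓ, hΓg⟩
    exact ⟨c • Γ, hΓ.const_smul c, fun l => by simp [hΓg]⟩

variable [CompleteSpace 𝔸]

theorem isClosed_discSubmodule : IsClosed (discSubmodule 𝔸 : Set C(Circle, 𝔸)) := by
  refine IsSeqClosed.isClosed fun h g hh hg => ?_
  choose Γ hΓ hΓh using hh
  have hlim : TendstoUniformly (fun N (l : Circle) => Γ N l) g atTop := by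
    simp only [hΓh]
    exact ContinuousMap.tendsto_iff_tendstoUniformly.1 hg
  obtain ⟨L, hL, hLg, -⟩ := exists_tendstoUniformlyOn_disc hΓ hlim
  exact ⟨L, hL, hLg⟩

theorem continuousMap_exp_apply (X : C(Circle, 𝔸)) (l : Circle) : (exp X) l = exp (X l) := by
  let _ : NormedAlgebra ℚ 𝔸 := .restrictScalars ℚ ℂ 𝔸
  exact map_exp (Pi.evalRingHom (fun _ : Circle => 𝔸) l |>.comp
    (ContinuousMap.coeFnRingHom (α := Circle) (β := 𝔸))) (continuous_eval_const l) X

/-- If `exp (-z D) c exp (z D)` extends to the disk for all `z` in an open set, then it does so for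
every `z`: its class modulo the functions that extend is an entire function of `z`. -/
theorem hasDiscExtension_conj_exp {D c : Circle → 𝔸} (hD : Continuous D) (hc : Continuous c)
    {O : Set ℂ} (hO : IsOpen O) (hne : O.Nonempty)
    (h : ∀ z ∈ O, HasDiscExtension fun l => exp (-(z • D l)) * c l * exp (z • D l)) (z : ℂ) :
    HasDiscExtension fun l => exp (-(z • D l)) * c l * exp (z • D l) := by
  let D' : C(Circle, 𝔸) := ⟨D, hD⟩
  let c' : C(Circle, 𝔸) := ⟨c, hc⟩
  let M : ℂ → C(Circle, 𝔸) := fun z => exp (z • (-D')) * c' * exp (z • D')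
  have hM : ∀ z l, M z l = exp (-(z • D l)) * c l * exp (z • D l) := by
    intro z l
    simp [M, continuousMap_exp_apply, D', c']
  have hMd : Differentiable ℂ M := by
    have h1 := differentiable_exp_smul_const ℂ (-D')
    have h2 := differentiable_exp_smul_const ℂ D'
    exact (h1.mul_const c').mul h2
  have hmem : ∀ z, M z ∈ discSubmodule 𝔸 ↔
      HasDiscExtension fun l => exp (-(z • D l)) * c l * exp (z • D l) := by
    intro z
    simp only [← hM]
    rfl
  rw [← hmem]
  have hcl : IsClosed (discSubmodule 𝔸 : Set C(Circle, 𝔸)) := isClosed_discSubmodule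
  let q := (discSubmodule 𝔸).mkQL
  have hq : ∀ x, q x = 0 ↔ x ∈ discSubmodule 𝔸 := fun x => Submodule.Quotient.mk_eq_zero _
  have hqd : Differentiable ℂ fun z => q (M z) := q.differentiable.comp hMd
  obtain ⟨z₀, hz₀⟩ := hne
  have := (hqd.differentiableOn (s := Set.univ)).analyticOnNhd isOpen_univ
    |>.eqOn_zero_of_preconnected_of_eventuallyEq_zero isPreconnected_univ (Set.mem_univ z₀)
      (by filter_upwards [hO.mem_nhds hz₀] with z hz
          exact (hq _).2 ((hmem z).2 (h z hz)))
  exact (hq _).1 (this (Set.mem_univ z))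

end Continuation

/-- A limit of units whose inverses stay bounded is a unit. -/
theorem isUnit_of_tendsto {𝔸 : Type*} [NormedRing 𝔸] [CompleteSpace 𝔸] {u : ℕ → 𝔸ˣ} {L : 𝔸} {C : ℝ}
    (hC : ∀ N, ‖((u N)⁻¹ : 𝔸ˣ).val‖ ≤ C)
    (hu : Tendsto (fun N => (u N : 𝔸)) atTop (𝓝 L)) : IsUnit L := by
  have h1 : Tendsto (fun N => ((u N)⁻¹ : 𝔸ˣ).val * L) atTop (𝓝 1) := by
    have h2 : Tendsto (fun N => ((u N)⁻¹ : 𝔸ˣ).val * (L - u N)) atTop (𝓝 0) := by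
      have h3 : Tendsto (fun N => C * ‖L - u N‖) atTop (𝓝 0) := by
        simpa using ((tendsto_const_nhds (x := L)).sub hu).norm.const_mul C
      exact squeeze_zero_norm (fun N => (norm_mul_le _ _).trans
        (mul_le_mul_of_nonneg_right (hC N) (norm_nonneg _))) h3
    simpa [mul_sub] using h2.add_const 1
  obtain ⟨N, hN⟩ := (h1.eventually (Units.isOpen.mem_nhds (by simp : (1 : 𝔸) ∈ _))).exists
  have h2 := (u N).isUnit.mul hN
  simpa [← mul_assoc] using h2

attribute [local instance] LieRing.ofAssociativeRing
attribute [local instance] Matrix.linftyOpNormedAddCommGroup Matrix.linftyOpNormedSpace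
  Matrix.linftyOpNormedRing Matrix.linftyOpNormedAlgebra

variable {n k : ℕ}

/-! ### Matrices of group elements -/

theorem norm_one_le (n : ℕ) : ‖(1 : Mat n)‖ ≤ 1 := by
  rcases isEmpty_or_nonempty (Fin n) with h | h
  · rw [Subsingleton.elim (1 : Mat n) 0, norm_zero]; exact zero_le_one
  · have := Matrix.linfty_opNormOneClass (n := Fin n) (α := ℂ)
    exact norm_one.le

@[simp] theorem matC_mul (g h : GL (Fin n) ℝ) : matC (g * h) = matC g * matC h := by
  simp [matC]

@[simp] theorem matC_one : matC (1 : GL (Fin n) ℝ) = 1 := by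
  simp [matC]

theorem matC_eq_map (g : GL (Fin n) ℝ) :
    matC g = (g : Matrix (Fin n) (Fin n) ℝ).map (algebraMap ℝ ℂ) := rfl

theorem matC_injective : Function.Injective (matC : GL (Fin n) ℝ → Mat n) := by
  intro g h hgh
  rw [matC_eq_map, matC_eq_map] at hgh
  exact Units.ext (Matrix.map_injective (algebraMap ℝ ℂ).injective hgh)

theorem matC_inv_mul (g : GL (Fin n) ℝ) : matC g⁻¹ * matC g = 1 := by
  rw [← matC_mul, inv_mul_cancel, matC_one]

theorem matC_mul_inv (g : GL (Fin n) ℝ) : matC g * matC g⁻¹ = 1 := by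
  rw [← matC_mul, mul_inv_cancel, matC_one]

theorem matC_mul_left_cancel {g : GL (Fin n) ℝ} {X Y : Mat n} (h : matC g * X = matC g * Y) :
    X = Y := by
  rw [← one_mul X, ← matC_inv_mul g, mul_assoc, h, ← mul_assoc, matC_inv_mul, one_mul]

theorem mat_exp_mul_exp_neg (X : Mat n) : exp X * exp (-X) = 1 := exp_mul_exp_neg (𝔸 := Mat n) X

theorem mat_exp_neg_mul_exp (X : Mat n) : exp (-X) * exp X = 1 := exp_neg_mul_exp (𝔸 := Mat n) X

theorem isEmbedding_unitsVal (n : ℕ) :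
    IsEmbedding (fun g : GL (Fin n) ℂ => (g : Mat n)) :=
  Units.isOpenEmbedding_val (R := Mat n) |>.isEmbedding

theorem isEmbedding_matC : IsEmbedding (matC : GL (Fin n) ℝ → Mat n) := by
  have h1 : IsEmbedding (fun g : GL (Fin n) ℝ => (g : Matrix (Fin n) (Fin n) ℝ)) :=
    Units.isOpenEmbedding_val (R := Matrix (Fin n) (Fin n) ℝ) |>.isEmbedding
  have h2 : IsEmbedding (fun A : Matrix (Fin n) (Fin n) ℝ => A.map (algebraMap ℝ ℂ)) :=
    Function.LeftInverse.isEmbedding (g := fun A : Matrix (Fin n) (Fin n) ℝ =>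
      A.map (algebraMap ℝ ℂ)) (f := fun A : Mat n => A.map Complex.re)
      (fun A => by ext i j; simp)
      (continuous_id.matrix_map Complex.continuous_re)
      (continuous_id.matrix_map Complex.continuous_ofReal)
  exact h2.comp h1

namespace KSymmetricSpace

variable (S : KSymmetricSpace n k)

@[simp] theorem mat_mul (g h : S.GC) : S.mat (g * h) = S.mat g * S.mat h := by simp [mat]

@[simp] theorem mat_one : S.mat 1 = 1 := by simp [mat]

theorem mat_injective : Function.Injective S.mat := fun _ _ h => Subtype.ext (Units.ext h)

theorem mat_inv_mul (g : S.GC) : S.mat g⁻¹ * S.mat g = 1 := by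
  rw [← mat_mul, inv_mul_cancel, mat_one]

theorem mat_mul_inv (g : S.GC) : S.mat g * S.mat g⁻¹ = 1 := by
  rw [← mat_mul, mul_inv_cancel, mat_one]

@[simp] theorem incl_mul (g h : S.G) : S.incl (g * h) = S.incl g * S.incl h :=
  Subtype.ext (by simp [incl])

@[simp] theorem incl_one : S.incl 1 = 1 := Subtype.ext (by simp [incl])

@[simp] theorem incl_inv (g : S.G) : S.incl g⁻¹ = (S.incl g)⁻¹ :=
  eq_inv_of_mul_eq_one_left (by rw [← incl_mul, inv_mul_cancel, incl_one])

theorem mat_incl (g : S.G) : S.mat (S.incl g) = matC (g : GL (Fin n) ℝ) := rfl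

theorem incl_injective : Function.Injective S.incl := by
  intro g h hgh
  exact Subtype.ext (matC_injective (congrArg S.mat hgh))

theorem isEmbedding_mat : IsEmbedding S.mat :=
  (isEmbedding_unitsVal n).comp IsEmbedding.subtypeVal

theorem isEmbedding_matC_G : IsEmbedding fun g : S.G => matC (g : GL (Fin n) ℝ) :=
  isEmbedding_matC.comp IsEmbedding.subtypeVal

theorem continuous_incl : Continuous S.incl :=
  S.isEmbedding_mat.continuous_iff.2 S.isEmbedding_matC_G.continuous

/-- `Gᶜ` is closed under limits of matrices, as soon as the limit is invertible. -/
theorem exists_tendsto_of_isUnit {u : ℕ → S.GC} {L : Mat n} (hL : IsUnit L)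
    (hu : Tendsto (fun N => S.mat (u N)) atTop (𝓝 L)) :
    ∃ g : S.GC, S.mat g = L ∧ Tendsto u atTop (𝓝 g) := by
  obtain ⟨v, rfl⟩ := hL
  have h1 : Tendsto (fun N => (u N : GL (Fin n) ℂ)) atTop (𝓝 v) :=
    (isEmbedding_unitsVal n).tendsto_nhds_iff.2 hu
  have hv : v ∈ S.GC := S.isClosed_GC.mem_of_tendsto h1 (Eventually.of_forall fun N => (u N).2)
  exact ⟨⟨v, hv⟩, rfl, S.isEmbedding_mat.tendsto_nhds_iff.2 hu⟩

/-- `X` lies in the complexified Lie algebra and `dσ X = Y`. -/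
def SigmaRel (X Y : Mat n) : Prop :=
  ∃ h : X ∈ complexify S.lieG, (S.dσ ⟨X, h⟩ : Mat n) = Y

variable {S}

theorem SigmaRel.mem {X Y : Mat n} (h : S.SigmaRel X Y) : X ∈ complexify S.lieG := h.1

theorem SigmaRel.add {X Y X' Y' : Mat n} (h : S.SigmaRel X Y) (h' : S.SigmaRel X' Y') :
    S.SigmaRel (X + X') (Y + Y') := by
  obtain ⟨h, rfl⟩ := h
  obtain ⟨h', rfl⟩ := h'
  exact ⟨add_mem h h', congrArg Subtype.val (S.dσ.map_add ⟨X, h⟩ ⟨X', h'⟩)⟩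

theorem SigmaRel.smul {X Y : Mat n} (h : S.SigmaRel X Y) (c : ℂ) :
    S.SigmaRel (c • X) (c • Y) := by
  obtain ⟨h, rfl⟩ := h
  exact ⟨Submodule.smul_mem _ c h, congrArg Subtype.val (S.dσ.map_smul c ⟨X, h⟩)⟩

theorem SigmaRel.sub {X Y X' Y' : Mat n} (h : S.SigmaRel X Y) (h' : S.SigmaRel X' Y') :
    S.SigmaRel (X - X') (Y - Y') := by
  simpa [sub_eq_add_neg] using h.add (h'.smul (-1))

theorem SigmaRel.unique {X Y Y' : Mat n} (h : S.SigmaRel X Y) (h' : S.SigmaRel X Y') : Y = Y' := by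
  obtain ⟨h, rfl⟩ := h
  obtain ⟨h', rfl⟩ := h'
  rfl

theorem SigmaRel.smul_real {X Y : Mat n} (h : S.SigmaRel X Y) (c : ℝ) :
    S.SigmaRel (c • X) (c • Y) := by
  simpa using h.smul (c : ℂ)

theorem coe_zeta (k : ℕ) : (zeta k : ℂ) = Complex.exp (2 * Real.pi * Complex.I / k) := by
  rw [zeta, Circle.coe_exp]
  congr 1
  push_cast
  ring

theorem sigmaRel_of_mem_eigen {j : ℤ} {X : Mat n} (h : X ∈ S.eigen j) :
    S.SigmaRel X ((zeta k : ℂ) ^ j • X) := by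
  rw [coe_zeta]
  exact h

theorem zeta_ne_one (S : KSymmetricSpace n k) : (zeta k : ℂ) ≠ 1 := by
  have hk : (2 : ℝ) ≤ k := by exact_mod_cast S.two_le_k
  rw [coe_zeta, Ne, Complex.exp_eq_one_iff]
  rintro ⟨m, hm⟩
  have h2 : (2 * Real.pi * Complex.I : ℂ) ≠ 0 := Complex.two_pi_I_ne_zero
  have hk0 : (k : ℂ) ≠ 0 := by
    have : (k : ℝ) ≠ 0 := by positivity
    exact_mod_cast this
  have h3 : (1 : ℂ) = m * k := by
    field_simp at hm
    rw [mul_comm]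
    exact_mod_cast hm
  have h4 : (1 : ℤ) = m * k := by exact_mod_cast h3
  have h5 : (k : ℤ) ∣ 1 := ⟨m, by rw [h4]; ring⟩
  have h6 := Int.le_of_dvd one_pos h5
  have := S.two_le_k
  omega

/-- Distinct eigenspaces of `dσ` meet in zero. -/
theorem eq_zero_of_sigmaRel {X : Mat n} {c : ℂ} (hc : c ≠ 1) (h : S.SigmaRel X (c • X))
    (h' : S.SigmaRel X X) : X = 0 := by
  have := h.unique h'
  have h2 : (c - 1) • X = 0 := by rw [sub_smul, this, one_smul, sub_self]
  exact (smul_eq_zero.1 h2).resolve_left (sub_ne_zero.2 hc)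

/-! ### Exponentials in the complexified group -/

theorem exists_mat_eq_exp {X : Mat n} (hX : X ∈ complexify S.lieG) :
    ∃ g : S.GC, S.mat g = exp X := by
  obtain ⟨g, hg, h⟩ := (S.mem_lieGC X).1 hX 1
  exact ⟨⟨g, hg⟩, by rw [one_smul] at h; exact h⟩

theorem SigmaRel.mat_sigma {X Y : Mat n} (h : S.SigmaRel X Y) {g : S.GC} (hg : S.mat g = exp X) :
    S.mat (S.σ g) = exp Y := by
  obtain ⟨h, rfl⟩ := h
  exact S.σ_exp ⟨X, h⟩ g hg

theorem SigmaRel.mem_KC {X : Mat n} (h : S.SigmaRel X X) {g : S.GC} (hg : S.mat g = exp X) :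
    g ∈ S.KC := by
  obtain ⟨h, h'⟩ := h
  exact S.exp_mem_KC ⟨X, h⟩ g (Subtype.ext h') hg

theorem eulerProd_succ_mat (B : ℝ → Mat n) (N i : ℕ) :
    eulerProd B N (i + 1) = eulerProd B N i * exp ((1 / N : ℝ) • B (i / N)) := rfl

theorem exists_mat_eq_eulerProd {B : ℝ → Mat n} (hB : ∀ s ∈ Set.Icc (0 : ℝ) 1,
    B s ∈ complexify S.lieG) {N i : ℕ} (hi : i ≤ N) :
    ∃ g : S.GC, S.mat g = eulerProd B N i ∧ S.mat g⁻¹ = eulerProdInv B N i := by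
  have h1 : ∃ g : S.GC, S.mat g = eulerProd B N i := by
    induction i with
    | zero => exact ⟨1, by simp [eulerProd]⟩
    | succ i ih =>
      obtain ⟨g, hg⟩ := ih ((Nat.le_succ i).trans hi)
      have hN : (0 : ℝ) < N := by exact_mod_cast (Nat.succ_pos i).trans_le hi
      have hmem : (i / N : ℝ) ∈ Set.Icc (0 : ℝ) 1 :=
        ⟨by positivity, by rw [div_le_one hN]; exact_mod_cast (Nat.le_succ i).trans hi⟩
      obtain ⟨h, hh⟩ := exists_mat_eq_exp (Submodule.smul_of_tower_mem _ (1 / N : ℝ) (hB _ hmem))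
      exact ⟨g * h, by rw [mat_mul, hg, hh, eulerProd_succ_mat]⟩
  obtain ⟨g, hg⟩ := h1
  refine ⟨g, hg, ?_⟩
  calc S.mat g⁻¹ = S.mat g⁻¹ * (eulerProd B N i * eulerProdInv B N i) := by
        rw [eulerProd_mul_inv, mul_one]
    _ = _ := by rw [← hg, ← mul_assoc, mat_inv_mul, one_mul]

theorem mat_sigma_eulerProd {B B' : ℝ → Mat n} (hB : ∀ s ∈ Set.Icc (0 : ℝ) 1,
    S.SigmaRel (B s) (B' s)) {N i : ℕ} (hi : i ≤ N) {g : S.GC} (hg : S.mat g = eulerProd B N i) :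
    S.mat (S.σ g) = eulerProd B' N i := by
  induction i generalizing g with
  | zero =>
    have : g = 1 := S.mat_injective (by rw [hg, mat_one, eulerProd])
    simp [this, eulerProd]
  | succ i ih =>
    obtain ⟨h, hh, -⟩ := exists_mat_eq_eulerProd (S := S) (fun s hs => (hB s hs).mem)
      ((Nat.le_succ i).trans hi)
    have hN : (0 : ℝ) < N := by exact_mod_cast (Nat.succ_pos i).trans_le hi
    have hmem : (i / N : ℝ) ∈ Set.Icc (0 : ℝ) 1 :=
      ⟨by positivity, by rw [div_le_one hN]; exact_mod_cast (Nat.le_succ i).trans hi⟩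
    have hr := (hB _ hmem).smul_real (1 / N)
    obtain ⟨e, he⟩ := exists_mat_eq_exp hr.mem
    have hgh : g = h * e := S.mat_injective (by rw [hg, mat_mul, hh, he, eulerProd_succ_mat])
    rw [hgh, map_mul, mat_mul, ih ((Nat.le_succ i).trans hi) hh, hr.mat_sigma he, eulerProd_succ_mat]

theorem mem_KC_of_eulerProd {B : ℝ → Mat n} (hB : ∀ s ∈ Set.Icc (0 : ℝ) 1,
    S.SigmaRel (B s) (B s)) {N i : ℕ} (hi : i ≤ N) {g : S.GC} (hg : S.mat g = eulerProd B N i) :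
    g ∈ S.KC := by
  induction i generalizing g with
  | zero =>
    have : g = 1 := S.mat_injective (by rw [hg, mat_one, eulerProd])
    rw [this]; exact one_mem _
  | succ i ih =>
    obtain ⟨h, hh, -⟩ := exists_mat_eq_eulerProd (S := S) (fun s hs => (hB s hs).mem)
      ((Nat.le_succ i).trans hi)
    have hN : (0 : ℝ) < N := by exact_mod_cast (Nat.succ_pos i).trans_le hi
    have hmem : (i / N : ℝ) ∈ Set.Icc (0 : ℝ) 1 :=
      ⟨by positivity, by rw [div_le_one hN]; exact_mod_cast (Nat.le_succ i).trans hi⟩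
    have hr := (hB _ hmem).smul_real (1 / N)
    obtain ⟨e, he⟩ := exists_mat_eq_exp hr.mem
    have hgh : g = h * e := S.mat_injective (by rw [hg, mat_mul, hh, he, eulerProd_succ_mat])
    rw [hgh]
    exact mul_mem (ih ((Nat.le_succ i).trans hi) hh) (hr.mem_KC he)

/-! ### Loops that extend to the disk -/

/-- The loop `γ` extends to a holomorphic map from the disk to `Gᶜ` with value in `Kᶜ` at the
origin; no twisting condition is imposed. -/
def ExtendsToDisc (γ : Circle → S.GC) : Prop :=
  ∃ Γ : ℂ → S.GC, DiffContOnCl ℂ (fun l => S.mat (Γ l)) (Metric.ball 0 1) ∧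
    Γ 0 ∈ S.KC ∧ ∀ l : Circle, Γ (l : ℂ) = γ l

theorem ExtendsToDisc.hasDiscExtension {γ : Circle → S.GC} (h : ExtendsToDisc γ) :
    HasDiscExtension fun l => S.mat (γ l) := by
  obtain ⟨Γ, hΓ, -, h⟩ := h
  exact ⟨_, hΓ, fun l => by simp only [h]⟩

theorem ExtendsToDisc.mul {γ δ : Circle → S.GC} (hγ : ExtendsToDisc γ) (hδ : ExtendsToDisc δ) :
    ExtendsToDisc fun l => γ l * δ l := by
  obtain ⟨Γ, hΓ, hΓ0, hΓγ⟩ := hγ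
  obtain ⟨Δ, hΔ, hΔ0, hΔδ⟩ := hδ
  refine ⟨fun l => Γ l * Δ l, ?_, mul_mem hΓ0 hΔ0, fun l => by simp only [hΓγ, hΔδ]⟩
  simp only [mat_mul]
  exact ⟨DifferentiableOn.mul (𝔸 := Mat n) hΓ.differentiableOn hΔ.differentiableOn,
    hΓ.continuousOn.mul hΔ.continuousOn⟩

theorem ExtendsToDisc.inv {γ : Circle → S.GC} (hγ : ExtendsToDisc γ) :
    ExtendsToDisc fun l => (γ l)⁻¹ := by
  obtain ⟨Γ, hΓ, hΓ0, hΓγ⟩ := hγ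
  refine ⟨fun l => (Γ l)⁻¹, ⟨fun z hz => ?_, ?_⟩, inv_mem hΓ0, fun l => by simp only [hΓγ]⟩
  · have h1 : ∀ z, S.mat (Γ z)⁻¹ = Ring.inverse (S.mat (Γ z)) := fun z =>
      (Ring.inverse_unit (Γ z : GL (Fin n) ℂ)).symm
    simp only [h1]
    exact DifferentiableWithinAt.inverse (R := Mat n) (hΓ.differentiableOn z hz) ⟨_, rfl⟩
  · have h1 : ContinuousOn Γ (closure (Metric.ball 0 1)) :=
      S.isEmbedding_mat.continuousOn_iff.2 hΓ.continuousOn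
    exact S.isEmbedding_mat.continuous.comp_continuousOn h1.inv

theorem incl_mem_KC {g : S.G} (hg : g ∈ S.K) : S.incl g ∈ S.KC := (S.mem_K_iff g).1 hg

theorem extendsToDisc_const {g : S.G} (hg : g ∈ S.K) :
    ExtendsToDisc fun _ : Circle => S.incl g :=
  ⟨fun _ => S.incl g, diffContOnCl_const, incl_mem_KC hg, fun _ => rfl⟩

/-- A loop in `G` whose matrices extend holomorphically to the disk is constant; the extension need
not be invertible inside the disk. -/
theorem eq_of_hasDiscExtension_of_real {γ : Circle → S.GC}
    {Γ : ℂ → Mat n} (hΓ : DiffContOnCl ℂ Γ (Metric.ball 0 1))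
    (hγ : ∀ l : Circle, Γ l = S.mat (γ l)) (hr : ∀ l, ∃ g : S.G, S.incl g = γ l) (l : Circle) :
    S.mat (γ l) = Γ 0 := by
  rw [← hγ l]
  ext i j
  have hproj : ∀ i j, DiffContOnCl ℂ (fun z => Γ z i j) (Metric.ball 0 1) := by
    intro i j
    let p : Mat n →L[ℂ] ℂ := ⟨Matrix.entryLinearMap ℂ ℂ i j, by
      exact (continuous_apply j).comp (continuous_apply i)⟩
    exact p.differentiable.comp_diffContOnCl hΓ
  refine eq_of_real_on_circle (hproj i j) (fun l => ?_) (by simp [Circle.norm_coe])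
  obtain ⟨g, hg⟩ := hr l
  rw [hγ l, ← hg, mat_incl, matC_eq_map]
  simp

/-- `ΛG_σ ∩ Λ⁺Gᶜ_σ` consists of constants in `K`. -/
theorem ExtendsToDisc.eq_const_of_real {γ : Circle → S.GC} (hγ : ExtendsToDisc γ)
    (hr : ∀ l, ∃ g : S.G, S.incl g = γ l) : ∃ κ ∈ S.K, ∀ l, γ l = S.incl κ := by
  obtain ⟨Γ, hΓ, hΓ0, hΓγ⟩ := hγ
  have h := eq_of_hasDiscExtension_of_real hΓ (fun l => by rw [hΓγ]) hr
  have h' : ∀ l, γ l = Γ 0 := fun l => S.mat_injective (h l)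
  obtain ⟨κ, hκ⟩ := hr 1
  refine ⟨κ, (S.mem_K_iff κ).2 ?_, fun l => by rw [hκ, h', h']⟩
  change S.incl κ ∈ S.KC
  rw [hκ, h']
  exact hΓ0

/-- A uniform limit on the circle of loops that extend to the disk extends to the disk, provided that
the inverses of the extensions are uniformly bounded: the bound keeps the limit invertible. -/
theorem extendsToDisc_of_tendstoUniformly {Γ : ℕ → ℂ → S.GC} {γ : Circle → S.GC}
    (hΓ : ∀ N, DiffContOnCl ℂ (fun l => S.mat (Γ N l)) (Metric.ball 0 1))
    (hΓ0 : ∀ N, Γ N 0 ∈ S.KC) {C : ℝ}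
    (hC : ∀ N, ∀ z ∈ Metric.closedBall (0 : ℂ) 1, ‖S.mat (Γ N z)⁻¹‖ ≤ C)
    (hlim : TendstoUniformly (fun N (l : Circle) => S.mat (Γ N l)) (fun l => S.mat (γ l)) atTop) :
    ExtendsToDisc γ := by
  obtain ⟨L, hL, hLγ, hunif⟩ := exists_tendstoUniformlyOn_disc hΓ hlim
  have h1 : ∀ z ∈ Metric.closedBall (0 : ℂ) 1, ∃ g : S.GC, S.mat g = L z ∧
      Tendsto (fun N => Γ N z) atTop (𝓝 g) := by
    intro z hz
    have hz' := hunif.tendsto_at hz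
    refine S.exists_tendsto_of_isUnit ?_ hz'
    exact isUnit_of_tendsto (𝔸 := Mat n) (u := fun N => (Γ N z : GL (Fin n) ℂ))
      (fun N => hC N z hz) hz'
  choose! g hg hg' using h1
  have hcl : ∀ z ∈ closure (Metric.ball (0 : ℂ) 1), S.mat (g z) = L z := fun z hz =>
    hg z (by rwa [closure_ball _ one_ne_zero] at hz)
  refine ⟨g, ⟨hL.differentiableOn.congr fun z hz => hcl z (subset_closure hz),
    hL.continuousOn.congr hcl⟩, ?_, fun l => S.mat_injective ?_⟩
  · exact S.isClosed_KC.mem_of_tendsto (hg' 0 (by simp)) (Eventually.of_forall hΓ0)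
  · rw [hg _ (by simp [Circle.norm_coe]), hLγ]

end KSymmetricSpace

/-! ### Linear total differential equations -/

theorem fderiv_eq_dz_dzbar (F : ℂ → Mat n) (z v : ℂ) :
    fderiv ℝ F z v = v • dz F z + (starRingEnd ℂ v) • dzbar F z := by
  have hv : fderiv ℝ F z v = v.re • fderiv ℝ F z 1 + v.im • fderiv ℝ F z Complex.I := by
    rw [← map_smul, ← map_smul, ← map_add]
    congr 1
    apply Complex.ext <;> simp
  have h1 : starRingEnd ℂ v = v.re - v.im * Complex.I := by
    apply Complex.ext <;> simp
  rw [hv, dz, dzbar, h1]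
  conv_rhs => rw [← Complex.re_add_im v]
  simp only [Complex.add_re, Complex.add_im, Complex.ofReal_re, Complex.ofReal_im, Complex.mul_re,
    Complex.mul_im, Complex.I_re, Complex.I_im]
  ext i j
  simp only [Matrix.add_apply, Matrix.smul_apply, Matrix.sub_apply, smul_eq_mul,
    Complex.real_smul, smul_sub, smul_add]
  push_cast
  ring_nf
  simp only [Complex.I_sq]
  ring

theorem dz_eq_of_fderiv {F : ℂ → Mat n} {z : ℂ} {X Y : Mat n}
    (h : ∀ v : ℂ, fderiv ℝ F z v = v • X + (starRingEnd ℂ v) • Y) : dz F z = X ∧ dzbar F z = Y := by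
  rw [dz, dzbar, h, h]
  constructor <;>
  · ext i j
    simp only [Matrix.add_apply, Matrix.smul_apply, Matrix.sub_apply, smul_eq_mul, map_one,
      Complex.conj_I]
    ring_nf
    simp only [Complex.I_sq]
    ring

/-- The differential equation `dF = F β` on `V`, for a matrix valued one-form `β`. -/
def Solves (β : ℂ → ℂ → Mat n) (V : Set ℂ) (F : ℂ → Mat n) : Prop :=
  ∀ z ∈ V, DifferentiableAt ℝ F z ∧ ∀ v : ℂ, fderiv ℝ F z v = F z * β z v

theorem Solves.const_mul {β : ℂ → ℂ → Mat n} {V : Set ℂ} {F : ℂ → Mat n} (h : Solves β V F)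
    (A : Mat n) : Solves β V fun z => A * F z := by
  intro z hz
  have h1 : HasFDerivAt (𝕜 := ℝ) (fun z => A * F z) _ z :=
    HasFDerivAt.const_mul (𝔸 := Mat n) (h z hz).1.hasFDerivAt A
  refine ⟨h1.differentiableAt, fun v => ?_⟩
  rw [h1.fderiv]
  change A * fderiv ℝ F z v = _
  rw [(h z hz).2, mul_assoc]

theorem Solves.comp_add {β : ℂ → ℂ → Mat n} {V V' : Set ℂ} {F : ℂ → Mat n} (h : Solves β V F)
    (w : ℂ) (hV : ∀ z ∈ V', z + w ∈ V) :
    Solves (fun z v => β (z + w) v) V' fun z => F (z + w) := by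
  intro z hz
  have h1 := h (z + w) (hV z hz)
  have h2 : HasFDerivAt (fun z => F (z + w)) (fderiv ℝ F (z + w)) z :=
    (hasFDerivAt_comp_add_right w).2 h1.1.hasFDerivAt
  exact ⟨h2.differentiableAt, fun v => by rw [h2.fderiv]; exact h1.2 v⟩

/-- The logarithmic derivative is determined by the solution. -/
theorem Solves.form_unique {β γ : ℂ → ℂ → Mat n} {V : Set ℂ} {F : ℂ → Mat n} (h : Solves β V F)
    (h' : Solves γ V F) {W : ℂ → Mat n} (hW : ∀ z, W z * F z = 1) {z : ℂ} (hz : z ∈ V) (v : ℂ) :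
    β z v = γ z v := by
  have h1 := ((h z hz).2 v).symm.trans ((h' z hz).2 v)
  calc β z v = W z * (F z * β z v) := by rw [← mul_assoc, hW, one_mul]
    _ = γ z v := by rw [h1, ← mul_assoc, hW, one_mul]

theorem differentiableAt_matC_inv {g : ℂ → GL (Fin n) ℝ} {z : ℂ}
    (hg : DifferentiableAt ℝ (fun z => matC (g z)) z) :
    DifferentiableAt ℝ (fun z => matC (g z)⁻¹) z := by
  have hW : ∀ z, matC (g z)⁻¹ = Ring.inverse (matC (g z)) := fun z => by
    have := (Ring.inverse_unit (toC n (g z)))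
    rw [← map_inv] at this
    exact this.symm
  simp only [hW]
  exact DifferentiableAt.inverse (R := Mat n) hg ⟨toC n (g z), rfl⟩

/-- Two solutions of `dF = F β`, one of them invertible, differ by a constant left factor. -/
theorem Solves.mul_const_on_preconnected {β : ℂ → ℂ → Mat n} {V : Set ℂ} (hV : IsOpen V)
    (hc : IsPreconnected V) {F : ℂ → Mat n} {g : ℂ → GL (Fin n) ℝ} (hF : Solves β V F)
    (hg : Solves β V fun z => matC (g z)) {z₀ z : ℂ} (hz₀ : z₀ ∈ V) (hz : z ∈ V) :
    F z * matC (g z)⁻¹ = F z₀ * matC (g z₀)⁻¹ := by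
  have hWd : ∀ z ∈ V, DifferentiableAt ℝ (fun z => matC (g z)⁻¹) z := fun z hz =>
    differentiableAt_matC_inv (hg z hz).1
  have hd : ∀ z ∈ V, HasFDerivAt (𝕜 := ℝ) (fun z => F z * matC (g z)⁻¹) 0 z := by
    intro z hz
    have h1 := HasFDerivAt.mul' (𝔸 := Mat n) (hF z hz).1.hasFDerivAt (hWd z hz).hasFDerivAt
    have h2 := HasFDerivAt.mul' (𝔸 := Mat n) (hg z hz).1.hasFDerivAt (hWd z hz).hasFDerivAt
    have h3 : HasFDerivAt (𝕜 := ℝ) (fun z => matC (g z) * matC (g z)⁻¹)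
        (0 : ℂ →L[ℝ] Mat n) z := by
      simp only [matC_mul_inv]
      exact hasFDerivAt_const _ _
    refine h1.congr_fderiv (ContinuousLinearMap.ext fun v => ?_)
    have h4 := congrArg (fun L : ℂ →L[ℝ] Mat n => L v) (h2.unique h3)
    change matC (g z) * fderiv ℝ (fun z => matC (g z)⁻¹) z v
      + fderiv ℝ (fun z => matC (g z)) z v * matC (g z)⁻¹ = 0 at h4
    change F z * fderiv ℝ (fun z => matC (g z)⁻¹) z v + fderiv ℝ F z v * matC (g z)⁻¹ = 0
    rw [(hg z hz).2, mul_assoc, ← mul_add] at h4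
    rw [(hF z hz).2, mul_assoc, ← mul_add]
    have h5 := congrArg (fun X => matC (g z)⁻¹ * X) h4
    simp only [← mul_assoc, matC_inv_mul, one_mul, mul_zero] at h5
    rw [h5, mul_zero]
  exact hV.is_const_of_fderiv_eq_zero hc (fun z hz => (hd z hz).differentiableAt.differentiableWithinAt)
    (fun z hz => (hd z hz).fderiv) hz hz₀

theorem Solves.hasDerivAt_segment {β : ℂ → ℂ → Mat n} {V : Set ℂ} {F : ℂ → Mat n}
    (h : Solves β V F) {z : ℂ} {s : ℝ} (hs : s • z ∈ V) :
    HasDerivAt (fun s : ℝ => F (s • z)) (F (s • z) * β (s • z) z) s := by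
  have h1 := (h _ hs).1.hasFDerivAt
  have h2 : HasDerivAt (fun s : ℝ => s • z) z s := by
    simpa using (hasDerivAt_id s).smul_const z
  rw [← (h _ hs).2]
  exact HasFDerivAt.comp_hasDerivAt s h1 h2

/-- The values of `β` are recovered from an invertible solution, so they are continuous. -/
theorem Solves.continuousOn_form {β : ℂ → ℂ → Mat n} {V : Set ℂ} (hV : IsOpen V)
    {g : ℂ → GL (Fin n) ℝ} (hg : Solves β V fun z => matC (g z))
    (hs : ContDiffOn ℝ ∞ (fun z => matC (g z)) V) (v : ℂ) : ContinuousOn (fun z => β z v) V := by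
  have h1 : ContinuousOn (fun z => fderiv ℝ (fun z => matC (g z)) z v) V :=
    (hs.continuousOn_fderiv_of_isOpen hV (by simp)).clm_apply continuousOn_const
  have h2 : ContinuousOn (fun z => matC (g z)⁻¹) V := by
    have h3 : ContinuousOn g V := isEmbedding_matC.continuousOn_iff.2 hs.continuousOn
    exact isEmbedding_matC.continuous.comp_continuousOn h3.inv
  refine (h2.mul h1).congr fun z hz => ?_
  change β z v = matC (g z)⁻¹ * fderiv ℝ (fun z => matC (g z)) z v
  rw [(hg z hz).2, ← mul_assoc, matC_inv_mul, one_mul]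

/-- The one-form `α_λ`, evaluated at the point `z` on the tangent vector `v`. -/
noncomputable def Form.eval (α : Form n) (l : Circle) (z v : ℂ) : Mat n :=
  v • α.coeffDz l z + (starRingEnd ℂ v) • α.coeffDzbar l z

theorem Form.IsSolution.solves {α : Form n} {l : Circle} {U : Set ℂ} (hU : IsOpen U)
    {F : ℂ → Mat n} (h : α.IsSolution l U F) (hF : ContDiffOn ℝ ∞ F U) : Solves (α.eval l) U F := by
  intro z hz
  refine ⟨(hF.contDiffAt (hU.mem_nhds hz)).differentiableAt (by simp), fun v => ?_⟩
  rw [fderiv_eq_dz_dzbar, (h z hz).1, (h z hz).2, Form.eval, mul_add, mul_smul_comm, mul_smul_comm]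

theorem Form.eval_injective {X Y X' Y' : Mat n}
    (h : ∀ v : ℂ, v • X + (starRingEnd ℂ v) • Y = v • X' + (starRingEnd ℂ v) • Y') :
    X = X' ∧ Y = Y' := by
  have h1 := h 1
  have h2 := congrArg (fun A => (-Complex.I) • A) (h Complex.I)
  simp only [one_smul, map_one, Complex.conj_I, smul_add, smul_smul] at h1 h2
  norm_num at h2
  have h3 : (2 : ℂ) • X = (2 : ℂ) • X' := by
    rw [two_smul, two_smul]
    calc X + X = (X + Y) + (X + -Y) := by abel
      _ = (X' + Y') + (X' + -Y') := by rw [h1, h2]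
      _ = X' + X' := by abel
  have h4 := smul_right_injective _ (two_ne_zero (α := ℂ)) h3
  exact ⟨h4, by rw [h4] at h1; exact add_left_cancel h1⟩

variable {S : KSymmetricSpace n k}

open KSymmetricSpace

/-! ### Extended frames -/

theorem laurent_bounded {P Q R : ℝ → Mat n} (hP : ContinuousOn P (Set.Icc 0 1))
    (hQ : ContinuousOn Q (Set.Icc 0 1)) (hR : ContinuousOn R (Set.Icc 0 1)) :
    ∃ M : ℝ, ∀ a c : ℂ, ‖a‖ ≤ 1 → ‖c‖ ≤ 1 → ∀ s ∈ Set.Icc (0 : ℝ) 1,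
      ‖a • P s + Q s + c • R s‖ ≤ M := by
  obtain ⟨p, hp⟩ := isCompact_Icc.exists_bound_of_continuousOn hP
  obtain ⟨q, hq⟩ := isCompact_Icc.exists_bound_of_continuousOn hQ
  obtain ⟨r, hr⟩ := isCompact_Icc.exists_bound_of_continuousOn hR
  refine ⟨p + q + r, fun a c ha hc s hs => (norm_add₃_le).trans ?_⟩
  have h1 : ‖a • P s‖ ≤ p := by
    rw [norm_smul]
    exact (mul_le_of_le_one_left (norm_nonneg _) ha).trans (hp s hs)
  have h2 : ‖c • R s‖ ≤ r := by
    rw [norm_smul]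
    exact (mul_le_of_le_one_left (norm_nonneg _) hc).trans (hr s hs)
  linarith [hq s hs]

/-- Uniform continuity in `s`, with `δ` independent of the coefficients `a`, `c`. -/
theorem laurent_equicontinuous {P Q R : ℝ → Mat n} (hP : ContinuousOn P (Set.Icc 0 1))
    (hQ : ContinuousOn Q (Set.Icc 0 1)) (hR : ContinuousOn R (Set.Icc 0 1)) :
    ∀ ε > 0, ∃ δ > 0, ∀ a c : ℂ, ‖a‖ ≤ 1 → ‖c‖ ≤ 1 → ∀ s ∈ Set.Icc (0 : ℝ) 1,
      ∀ t ∈ Set.Icc (0 : ℝ) 1, |s - t| < δ →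
        ‖(a • P s + Q s + c • R s) - (a • P t + Q t + c • R t)‖ ≤ ε := by
  intro ε hε
  have key : ∀ {X : ℝ → Mat n}, ContinuousOn X (Set.Icc 0 1) → ∃ δ > 0,
      ∀ s ∈ Set.Icc (0 : ℝ) 1, ∀ t ∈ Set.Icc (0 : ℝ) 1, |s - t| < δ → ‖X s - X t‖ ≤ ε / 3 := by
    intro X hX
    have h1 := isCompact_Icc.uniformContinuousOn_of_continuous hX
    obtain ⟨δ, hδ, h⟩ := (Metric.uniformContinuousOn_iff (β := Mat n)).1 h1 (ε / 3) (by positivity)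
    refine ⟨δ, hδ, fun s hs t ht hst => ?_⟩
    have := h s hs t ht hst
    rw [dist_eq_norm] at this
    exact this.le
  obtain ⟨δ₁, h₁, hp⟩ := key hP
  obtain ⟨δ₂, h₂, hq⟩ := key hQ
  obtain ⟨δ₃, h₃, hr⟩ := key hR
  refine ⟨min δ₁ (min δ₂ δ₃), by positivity, fun a c ha hc s hs t ht hst => ?_⟩
  simp only [lt_min_iff] at hst
  have h1 : ‖a • (P s - P t)‖ ≤ ε / 3 := by
    rw [norm_smul]
    exact (mul_le_of_le_one_left (norm_nonneg _) ha).trans (hp s hs t ht hst.1)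
  have h2 : ‖c • (R s - R t)‖ ≤ ε / 3 := by
    rw [norm_smul]
    exact (mul_le_of_le_one_left (norm_nonneg _) hc).trans (hr s hs t ht hst.2.2)
  have h3 := hq s hs t ht hst.2.1
  have h4 : (a • P s + Q s + c • R s) - (a • P t + Q t + c • R t)
      = a • (P s - P t) + (Q s - Q t) + c • (R s - R t) := by
    rw [smul_sub, smul_sub]; abel
  rw [h4]
  exact norm_add₃_le.trans (by linarith)

theorem continuous_eulerProd_param {Λ : Type*} [TopologicalSpace Λ] {B : Λ → ℝ → Mat n}
    (hB : ∀ s, Continuous fun l => B l s) (N i : ℕ) : Continuous fun l => eulerProd (B l) N i := by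
  induction i with
  | zero => exact continuous_const
  | succ i ih =>
    have : Continuous (exp : Mat n → Mat n) := exp_continuous
    exact ih.mul (this.comp ((hB (i / N)).const_smul (1 / N : ℝ)))

theorem differentiable_eulerProd_param {B : ℂ → ℝ → Mat n}
    (hB : ∀ s, Differentiable ℂ fun l => B l s) (N i : ℕ) :
    Differentiable ℂ fun l => eulerProd (B l) N i := by
  induction i with
  | zero => exact differentiable_const _
  | succ i ih =>
    have : Differentiable ℂ (exp : Mat n → Mat n) := fun x =>
      (exp_analytic (𝕂 := ℂ) x).differentiableAt
    exact Differentiable.mul (𝔸 := Mat n) ih (this.comp ((hB _).const_smul (1 / N : ℝ)))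

/-- An extended frame `E_λ` on a convex open neighbourhood `U` of `0` that is invariant under real
translations, for a primitive one-form that is invariant under real translations. -/
structure ExtendedFrame (S : KSymmetricSpace n k) (U : Set ℂ) (α : Form n)
    (E : Circle → ℂ → S.G) : Prop where
  isOpen : IsOpen U
  convex : Convex ℝ U
  zero_mem : (0 : ℂ) ∈ U
  add_real : ∀ z ∈ U, ∀ t : ℝ, z + t ∈ U
  primitive : α.IsPrimitive S U
  smooth : ∀ l, ContDiffOn ℝ ∞ (fun z => matC (E l z : GL (Fin n) ℝ)) U
  solution : ∀ l, α.IsSolution l U fun z => matC (E l z : GL (Fin n) ℝ)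
  init : ∀ l, E l 0 = 1
  eval_add_real : ∀ l, ∀ z ∈ U, ∀ (t : ℝ) (v : ℂ), α.eval l (z + t) v = α.eval l z v

namespace Form

variable {U : Set ℂ} {α : Form n}

theorem IsPrimitive.sigmaRel_coeffDz (h : α.IsPrimitive S U) {z : ℂ} (hz : z ∈ U) (l : Circle) :
    S.SigmaRel (α.coeffDz l z) (α.coeffDz (zeta k * l) z) := by
  obtain ⟨h1, h2, -, -⟩ := h.1 z hz
  have := ((sigmaRel_of_mem_eigen h1).smul ((l : ℂ)⁻¹)).add (sigmaRel_of_mem_eigen h2)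
  rw [zpow_zero, one_smul, smul_smul, zpow_neg_one, ← mul_inv, mul_comm (l : ℂ)] at this
  exact this

theorem IsPrimitive.sigmaRel_coeffDzbar (h : α.IsPrimitive S U) {z : ℂ} (hz : z ∈ U)
    (l : Circle) : S.SigmaRel (α.coeffDzbar l z) (α.coeffDzbar (zeta k * l) z) := by
  obtain ⟨-, -, h1, h2⟩ := h.1 z hz
  have := ((sigmaRel_of_mem_eigen h1).smul (l : ℂ)).add (sigmaRel_of_mem_eigen h2)
  rw [zpow_zero, one_smul, smul_smul, zpow_one, mul_comm (l : ℂ)] at this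
  exact this

theorem IsPrimitive.sigmaRel_eval (h : α.IsPrimitive S U) {z : ℂ} (hz : z ∈ U) (l : Circle)
    (v : ℂ) : S.SigmaRel (α.eval l z v) (α.eval (zeta k * l) z v) :=
  ((h.sigmaRel_coeffDz hz l).smul v).add ((h.sigmaRel_coeffDzbar hz l).smul _)

theorem coeffDz_eq_eval (l : Circle) (z : ℂ) :
    α.coeffDz l z = (1 / 2 : ℂ) • (α.eval l z 1 - Complex.I • α.eval l z Complex.I) := by
  simp only [eval, one_smul, map_one, Complex.conj_I, smul_add, smul_smul, smul_sub]
  simp only [mul_neg, Complex.I_mul_I]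
  module

theorem coeffDzbar_eq_eval (l : Circle) (z : ℂ) :
    α.coeffDzbar l z = (1 / 2 : ℂ) • (α.eval l z 1 + Complex.I • α.eval l z Complex.I) := by
  simp only [eval, one_smul, map_one, Complex.conj_I, smul_add, smul_smul]
  simp only [mul_neg, Complex.I_mul_I]
  module

theorem m'_eq (z : ℂ) : α.m' z = (1 / 2 : ℂ) • (α.coeffDz 1 z - α.coeffDz (-1) z) := by
  simp only [coeffDz, Circle.coe_one, Circle.coe_neg, inv_one, inv_neg]
  module

theorem k'_eq (z : ℂ) : α.k' z = (1 / 2 : ℂ) • (α.coeffDz 1 z + α.coeffDz (-1) z) := by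
  simp only [coeffDz, Circle.coe_one, Circle.coe_neg, inv_one, inv_neg]
  module

theorem m''_eq (z : ℂ) : α.m'' z = (1 / 2 : ℂ) • (α.coeffDzbar 1 z - α.coeffDzbar (-1) z) := by
  simp only [coeffDzbar, Circle.coe_one, Circle.coe_neg]
  module

theorem k''_eq (z : ℂ) : α.k'' z = (1 / 2 : ℂ) • (α.coeffDzbar 1 z + α.coeffDzbar (-1) z) := by
  simp only [coeffDzbar, Circle.coe_one, Circle.coe_neg]
  module

theorem eval_eq_laurent (l : Circle) (z v : ℂ) :
    α.eval l z v = (l : ℂ)⁻¹ • (v • α.m' z) + (v • α.k' z + starRingEnd ℂ v • α.k'' z)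
      + (l : ℂ) • (starRingEnd ℂ v • α.m'' z) := by
  simp only [eval, coeffDz, coeffDzbar]
  module

end Form

namespace ExtendedFrame

variable {U : Set ℂ} {α : Form n} {E : Circle → ℂ → S.G}

theorem solves (h : ExtendedFrame S U α E) (l : Circle) :
    Solves (α.eval l) U fun z => matC (E l z : GL (Fin n) ℝ) :=
  (h.solution l).solves h.isOpen (h.smooth l)

theorem smul_mem (h : ExtendedFrame S U α E) {z : ℂ} (hz : z ∈ U) {s : ℝ}
    (hs : s ∈ Set.Icc (0 : ℝ) 1) : s • z ∈ U :=
  h.convex.smul_mem_of_zero_mem h.zero_mem hz hs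

theorem continuousOn_coeffDz (h : ExtendedFrame S U α E) (l : Circle) :
    ContinuousOn (α.coeffDz l) U := by
  have h1 := (h.solves l).continuousOn_form h.isOpen (h.smooth l)
  refine (((h1 1).sub ((h1 Complex.I).const_smul Complex.I)).const_smul (1 / 2 : ℂ)).congr
    fun z _ => ?_
  exact Form.coeffDz_eq_eval l z

theorem continuousOn_coeffDzbar (h : ExtendedFrame S U α E) (l : Circle) :
    ContinuousOn (α.coeffDzbar l) U := by
  have h1 := (h.solves l).continuousOn_form h.isOpen (h.smooth l)
  refine (((h1 1).add ((h1 Complex.I).const_smul Complex.I)).const_smul (1 / 2 : ℂ)).congr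
    fun z _ => ?_
  exact Form.coeffDzbar_eq_eval l z

theorem continuousOn_m' (h : ExtendedFrame S U α E) : ContinuousOn α.m' U :=
  (((h.continuousOn_coeffDz 1).sub (h.continuousOn_coeffDz (-1))).const_smul (1 / 2 : ℂ)).congr
    fun z _ => Form.m'_eq z

theorem continuousOn_k' (h : ExtendedFrame S U α E) : ContinuousOn α.k' U :=
  (((h.continuousOn_coeffDz 1).add (h.continuousOn_coeffDz (-1))).const_smul (1 / 2 : ℂ)).congr
    fun z _ => Form.k'_eq z

theorem continuousOn_m'' (h : ExtendedFrame S U α E) : ContinuousOn α.m'' U :=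
  (((h.continuousOn_coeffDzbar 1).sub (h.continuousOn_coeffDzbar (-1))).const_smul
    (1 / 2 : ℂ)).congr fun z _ => Form.m''_eq z

theorem continuousOn_k'' (h : ExtendedFrame S U α E) : ContinuousOn α.k'' U :=
  (((h.continuousOn_coeffDzbar 1).add (h.continuousOn_coeffDzbar (-1))).const_smul
    (1 / 2 : ℂ)).congr fun z _ => Form.k''_eq z

theorem continuousOn_segment (h : ExtendedFrame S U α E) {z : ℂ} (hz : z ∈ U) {X : ℂ → Mat n}
    (hX : ContinuousOn X U) : ContinuousOn (fun s : ℝ => X (s • z)) (Set.Icc 0 1) :=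
  hX.comp (by fun_prop) fun _ hs => h.smul_mem hz hs

/-- The Euler products along the segment from `0` to `z` converge to `E_λ(z)`, uniformly in `λ`. -/
theorem tendstoUniformly (h : ExtendedFrame S U α E) {z : ℂ} (hz : z ∈ U) :
    TendstoUniformly (fun N l => eulerProd (fun s => α.eval l (s • z) z) N N)
      (fun l => matC (E l z : GL (Fin n) ℝ)) atTop := by
  have hP : ContinuousOn (fun s : ℝ => z • α.m' (s • z)) (Set.Icc 0 1) :=
    (h.continuousOn_segment hz h.continuousOn_m').const_smul z
  have hQ : ContinuousOn (fun s : ℝ => z • α.k' (s • z) + starRingEnd ℂ z • α.k'' (s • z))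
      (Set.Icc 0 1) :=
    ((h.continuousOn_segment hz h.continuousOn_k').const_smul z).add
      ((h.continuousOn_segment hz h.continuousOn_k'').const_smul (starRingEnd ℂ z))
  have hR : ContinuousOn (fun s : ℝ => starRingEnd ℂ z • α.m'' (s • z)) (Set.Icc 0 1) :=
    (h.continuousOn_segment hz h.continuousOn_m'').const_smul (starRingEnd ℂ z)
  obtain ⟨M, hM⟩ := laurent_bounded hP hQ hR
  have hE := laurent_equicontinuous hP hQ hR
  have hn : ∀ l : Circle, ‖((l : ℂ)⁻¹)‖ ≤ 1 ∧ ‖(l : ℂ)‖ ≤ 1 := fun l => by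
    simp [Circle.norm_coe]
  have := tendstoUniformly_eulerProd (𝔸 := Mat n) (norm_one_le n)
    (B := fun (l : Circle) s => α.eval l (s • z) z)
    (Y := fun l s => matC (E l (s • z) : GL (Fin n) ℝ)) (M := M)
    (fun l s hs => (h.solves l).hasDerivAt_segment (h.smul_mem hz hs))
    (fun l => by simp [h.init])
    (fun l s hs => by
      rw [Form.eval_eq_laurent]; exact hM _ _ (hn l).1 (hn l).2 s hs)
    (fun ε hε => by
      obtain ⟨δ, hδ, h'⟩ := hE ε hε
      refine ⟨δ, hδ, fun l s hs t ht hst => ?_⟩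
      rw [Form.eval_eq_laurent, Form.eval_eq_laurent]
      exact h' _ _ (hn l).1 (hn l).2 s hs t ht hst)
  simp only [one_smul] at this
  exact this

theorem continuous_param (h : ExtendedFrame S U α E) {z : ℂ} (hz : z ∈ U) :
    Continuous fun l => E l z := by
  refine S.isEmbedding_matC_G.continuous_iff.2 ?_
  refine (h.tendstoUniformly hz).continuous (Frequently.of_forall fun N => ?_)
  refine continuous_eulerProd_param (fun s => ?_) N N
  have h1 : Continuous fun l : Circle => (l : ℂ) := continuous_subtype_val
  have h2 : Continuous fun l : Circle => (l : ℂ)⁻¹ := h1.inv₀ fun l => l.coe_ne_zero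
  simp only [Form.eval_eq_laurent]
  exact ((h2.smul continuous_const).add continuous_const).add (h1.smul continuous_const)

/-- The twisting condition `σ (E_λ) = E_{ζλ}`. -/
theorem sigma_incl (h : ExtendedFrame S U α E) {z : ℂ} (hz : z ∈ U) (l : Circle) :
    S.σ (S.incl (E l z)) = S.incl (E (zeta k * l) z) := by
  have hr : ∀ s ∈ Set.Icc (0 : ℝ) 1,
      S.SigmaRel (α.eval l (s • z) z) (α.eval (zeta k * l) (s • z) z) := fun s hs =>
    h.primitive.sigmaRel_eval (h.smul_mem hz hs) l z
  choose g hg _ using fun N : ℕ =>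
    exists_mat_eq_eulerProd (S := S) (fun s hs => (hr s hs).mem) (le_refl N)
  have h1 : Tendsto g atTop (𝓝 (S.incl (E l z))) := by
    refine S.isEmbedding_mat.tendsto_nhds_iff.2 ?_
    have := (h.tendstoUniformly hz).tendsto_at l
    exact this.congr fun N => (hg N).symm
  have h2 : Tendsto (fun N => S.mat (S.σ (g N))) atTop (𝓝 (S.mat (S.σ (S.incl (E l z))))) :=
    (S.isEmbedding_mat.continuous.comp S.continuous_σ).continuousAt.tendsto.comp h1
  have h3 := (h.tendstoUniformly hz).tendsto_at (zeta k * l)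
  refine S.mat_injective (tendsto_nhds_unique h2 (h3.congr fun N => ?_))
  exact (mat_sigma_eulerProd hr le_rfl (hg N)).symm

/-- `E_λ(z + t) = E_λ(t) E_λ(z)` for real `t`. -/
theorem add_real_eq (h : ExtendedFrame S U α E) (l : Circle) {z : ℂ} (hz : z ∈ U) (t : ℝ) :
    E l (z + t) = E l t * E l z := by
  have h1 : Solves (α.eval l) U fun z => matC (E l (z + t) : GL (Fin n) ℝ) := by
    have := (h.solves l).comp_add (t : ℂ) fun z hz => h.add_real z hz t
    intro z hz
    refine ⟨(this z hz).1, fun v => ?_⟩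
    rw [(this z hz).2]
    simp only [h.eval_add_real l z hz]
  have h2 := h1.mul_const_on_preconnected h.isOpen h.convex.isPreconnected (h.solves l)
    h.zero_mem hz
  simp only [zero_add, h.init, OneMemClass.coe_one, inv_one, matC_one, mul_one] at h2
  rw [← matC_mul] at h2
  have h3 := matC_injective h2
  have h4 : E l (z + t) * (E l z)⁻¹ = E l t := Subtype.ext h3
  rw [← h4, inv_mul_cancel_right]

theorem real_mem (h : ExtendedFrame S U α E) (t : ℝ) : (t : ℂ) ∈ U := by
  simpa using h.add_real 0 h.zero_mem t

theorem eval_zero_one (l : Circle) : α.eval l 0 1 = α.delaunay l := by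
  simp [Form.eval, Form.delaunay]

theorem hasDerivAt_real (h : ExtendedFrame S U α E) (l : Circle) {z : ℂ} (hz : z ∈ U) :
    HasDerivAt (fun t : ℝ => matC (E l (z + t) : GL (Fin n) ℝ))
      (matC (E l z : GL (Fin n) ℝ) * α.eval l z 1) 0 := by
  have h1 := h.solves l z hz
  have h2 : HasDerivAt (fun t : ℝ => z + (t : ℂ)) 1 0 := by
    simpa using (Complex.ofRealCLM.hasDerivAt (x := (0 : ℝ))).const_add z
  have h3 : HasFDerivAt (fun z => matC (E l z : GL (Fin n) ℝ))
      (fderiv ℝ (fun z => matC (E l z : GL (Fin n) ℝ)) z) (z + ((0 : ℝ) : ℂ)) := by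
    simpa using h1.1.hasFDerivAt
  rw [← h1.2]
  exact h3.comp_hasDerivAt (0 : ℝ) h2

/-- `E_λ(t) = exp (t D(λ))` for real `t`. -/
theorem real_eq_exp (h : ExtendedFrame S U α E) (l : Circle) (t : ℝ) :
    matC (E l t : GL (Fin n) ℝ) = exp (t • α.delaunay l) := by
  have h1 : ∀ t : ℝ, HasDerivAt (fun t : ℝ => matC (E l t : GL (Fin n) ℝ))
      (matC (E l t : GL (Fin n) ℝ) * α.delaunay l) t := by
    intro t
    have h2 := h.hasDerivAt_real l (h.real_mem t)
    have h3 := h.eval_add_real l 0 h.zero_mem t 1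
    rw [zero_add] at h3
    rw [h3, eval_zero_one] at h2
    have h4 := HasDerivAt.comp_sub_const (𝕜 := ℝ) (F := Mat n) t t
      (by rw [sub_self]; exact h2)
    refine h4.congr_of_eventuallyEq (Eventually.of_forall fun s => ?_)
    simp
  have h2 : ∀ t : ℝ, HasDerivAt (fun t : ℝ => matC (E l t : GL (Fin n) ℝ)
      * exp (t • -α.delaunay l)) 0 t := by
    intro t
    have h3 : HasDerivAt (fun t : ℝ => exp (t • -α.delaunay l))
        (-α.delaunay l * exp (t • -α.delaunay l)) t := hasDerivAt_exp_smul_const' (𝔸 := Mat n) _ t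
    have h4 := HasDerivAt.mul (𝔸 := Mat n) (h1 t) h3
    refine h4.congr_deriv ?_
    noncomm_ring
  have h3 := is_const_of_deriv_eq_zero (fun t => (h2 t).differentiableAt) (fun t => (h2 t).deriv)
    t 0
  simp only [Complex.ofReal_zero, h.init, zero_smul, exp_zero, OneMemClass.coe_one, matC_one,
    mul_one] at h3
  have h5 : exp (t • -α.delaunay l) * exp (t • α.delaunay l) = 1 := by
    rw [smul_neg]; exact exp_neg_mul_exp (𝔸 := Mat n) _
  calc _ = matC (E l t : GL (Fin n) ℝ) * (exp (t • -α.delaunay l) * exp (t • α.delaunay l)) := by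
        rw [h5, mul_one]
    _ = _ := by rw [← mul_assoc, h3, one_mul]

/-- `D(λ) E_λ = E_λ α_λ(∂_u)`: the infinitesimal form of the real translation invariance. -/
theorem delaunay_mul (h : ExtendedFrame S U α E) (l : Circle) {z : ℂ} (hz : z ∈ U) :
    α.delaunay l * matC (E l z : GL (Fin n) ℝ) = matC (E l z : GL (Fin n) ℝ) * α.eval l z 1 := by
  have h1 := h.hasDerivAt_real l hz
  have h2 : HasDerivAt (fun t : ℝ => exp (t • α.delaunay l)) (α.delaunay l) 0 := by
    have h3 := hasDerivAt_exp_smul_const (𝔸 := Mat n) (α.delaunay l) (0 : ℝ)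
    rw [zero_smul, exp_zero, one_mul] at h3
    exact h3
  have h3 := HasDerivAt.mul_const (𝔸 := Mat n) h2 (matC (E l z : GL (Fin n) ℝ))
  refine h3.unique (h1.congr_of_eventuallyEq (Eventually.of_forall fun t => ?_))
  simp only [h.add_real_eq l hz t, ← h.real_eq_exp, Subgroup.coe_mul, matC_mul]

/-! ### The factorization of the extended frame -/

theorem sigmaRel_delaunay (h : ExtendedFrame S U α E) (l : Circle) :
    S.SigmaRel (α.delaunay l) (α.delaunay (zeta k * l)) := by
  simpa only [eval_zero_one] using h.primitive.sigmaRel_eval h.zero_mem l 1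

theorem _root_.LoopTE.Form.continuous_delaunay (α : Form n) : Continuous α.delaunay := by
  have h1 : Continuous fun l : Circle => (l : ℂ) := continuous_subtype_val
  have h2 : Continuous fun l : Circle => (l : ℂ)⁻¹ := h1.inv₀ fun l => l.coe_ne_zero
  exact ((h2.smul continuous_const).add continuous_const).add
    ((h1.smul continuous_const).add continuous_const)

theorem exists_expLoop (h : ExtendedFrame S U α E) (w : ℂ) :
    ∃ e ∈ LoopC S, ∀ l, S.mat (e l) = exp (w • α.delaunay l) := by
  have hr : ∀ l, S.SigmaRel (w • α.delaunay l) (w • α.delaunay (zeta k * l)) := fun l =>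
    (h.sigmaRel_delaunay l).smul w
  choose e he using fun l => exists_mat_eq_exp (hr l).mem
  have hexp : Continuous (exp : Mat n → Mat n) := exp_continuous
  refine ⟨e, ⟨?_, fun l => S.mat_injective ?_⟩, he⟩
  · refine S.isEmbedding_mat.continuous_iff.2 ?_
    have : S.mat ∘ e = fun l => exp (w • α.delaunay l) := funext he
    rw [this]
    exact hexp.comp (α.continuous_delaunay.const_smul w)
  · rw [(hr l).mat_sigma (he l), he]

theorem loopC_mul {γ δ : Circle → S.GC} (hγ : γ ∈ LoopC S) (hδ : δ ∈ LoopC S) :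
    (fun l => γ l * δ l) ∈ LoopC S :=
  ⟨hγ.1.mul hδ.1, fun l => by rw [map_mul, hγ.2, hδ.2]⟩

theorem loopC_inv {γ : Circle → S.GC} (hγ : γ ∈ LoopC S) : (fun l => (γ l)⁻¹) ∈ LoopC S :=
  ⟨hγ.1.inv, fun l => by rw [map_inv, hγ.2]⟩

theorem loopC_incl (h : ExtendedFrame S U α E) {z : ℂ} (hz : z ∈ U) :
    (fun l => S.incl (E l z)) ∈ LoopC S :=
  ⟨S.continuous_incl.comp (h.continuous_param hz), h.sigma_incl hz⟩

/-- `E_λ(z) = exp (z D(λ)) V(λ)` with `V` in `Λ⁺Gᶜ_σ`. Along the segment from `0` to `z`, the factor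
`V` solves a linear differential equation whose coefficient `(z̄ - z) (λ α''_𝔪 + α''_𝔨)` is a
polynomial in `λ` with constant term in `𝔤₀`. -/
theorem exists_factorization (h : ExtendedFrame S U α E) {z : ℂ} (hz : z ∈ U) :
    ∃ V ∈ LoopC S, ExtendsToDisc V ∧
      ∀ l, S.mat (S.incl (E l z)) = exp (z • α.delaunay l) * S.mat (V l) := by
  obtain ⟨e, heC, he⟩ := h.exists_expLoop z
  refine ⟨fun l => (e l)⁻¹ * S.incl (E l z), loopC_mul (loopC_inv heC) (h.loopC_incl hz), ?_,
    fun l => ?_⟩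
  swap
  · rw [mat_mul, ← he, ← mul_assoc, mat_mul_inv, one_mul]
  -- `B μ s` is the coefficient at the point `s z` of the equation for `V`; it is defined for every
  -- complex `μ`, so its Euler products are the extensions to the disk of their values for `μ = λ`.
  set c : ℂ := starRingEnd ℂ z - z with hc
  let Q : ℝ → Mat n := fun s => c • α.k'' (s • z)
  let R : ℝ → Mat n := fun s => c • α.m'' (s • z)
  have hQ : ContinuousOn Q (Set.Icc 0 1) :=
    (h.continuousOn_segment hz h.continuousOn_k'').const_smul c
  have hR : ContinuousOn R (Set.Icc 0 1) :=
    (h.continuousOn_segment hz h.continuousOn_m'').const_smul c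
  have h0 : ContinuousOn (fun _ : ℝ => (0 : Mat n)) (Set.Icc 0 1) := continuousOn_const
  obtain ⟨M, hM⟩ := laurent_bounded h0 hQ hR
  have hEq := laurent_equicontinuous h0 hQ hR
  let B : ℂ → ℝ → Mat n := fun μ s => Q s + μ • R s
  have hBM : ∀ μ : ℂ, ‖μ‖ ≤ 1 → ∀ s ∈ Set.Icc (0 : ℝ) 1, ‖B μ s‖ ≤ M := by
    intro μ hμ s hs
    simpa using hM 0 μ (by simp) hμ s hs
  have hmem : ∀ μ, ∀ s ∈ Set.Icc (0 : ℝ) 1, B μ s ∈ complexify S.lieG := by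
    intro μ s hs
    obtain ⟨-, -, h1, h2⟩ := h.primitive.1 _ (h.smul_mem hz hs)
    exact add_mem (Submodule.smul_mem _ _ h2.1)
      (Submodule.smul_mem _ _ (Submodule.smul_mem _ _ h1.1))
  have hfix : ∀ s ∈ Set.Icc (0 : ℝ) 1, S.SigmaRel (B 0 s) (B 0 s) := by
    intro s hs
    obtain ⟨-, -, -, h2⟩ := h.primitive.1 _ (h.smul_mem hz hs)
    have := (sigmaRel_of_mem_eigen h2).smul c
    rw [zpow_zero, one_smul] at this
    simpa [B, Q] using this
  choose Γ hΓ hΓi using fun (N : ℕ) (μ : ℂ) =>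
    exists_mat_eq_eulerProd (S := S) (hmem μ) (le_refl N)
  refine extendsToDisc_of_tendstoUniformly (Γ := Γ) (C := Real.exp M) (fun N => ?_) (fun N => ?_)
    (fun N μ hμ => ?_) ?_
  · have : (fun μ => S.mat (Γ N μ)) = fun μ => eulerProd (B μ) N N := funext (hΓ N)
    rw [this]
    exact (differentiable_eulerProd_param (fun s =>
      (differentiable_id.smul_const (R s)).const_add (Q s)) N N).diffContOnCl
  · exact mem_KC_of_eulerProd hfix le_rfl (hΓ N 0)
  · rw [hΓi]
    exact (norm_eulerProd_self_le (𝔸 := Mat n) (norm_one_le n)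
      (hBM μ (by simpa using hμ)) le_rfl).2
  · have hn : ∀ l : Circle, ‖(l : ℂ)‖ ≤ 1 := fun l => by simp [Circle.norm_coe]
    have hY : ∀ l : Circle, ∀ s ∈ Set.Icc (0 : ℝ) 1,
        HasDerivAt (fun s : ℝ => exp (s • (-(z • α.delaunay l)))
          * matC (E l (s • z) : GL (Fin n) ℝ))
          (exp (s • (-(z • α.delaunay l))) * matC (E l (s • z) : GL (Fin n) ℝ) * B l s) s := by
      intro l s hs
      have hsU := h.smul_mem hz hs
      have h1 := (h.solves l).hasDerivAt_segment hsU
      have h2 := hasDerivAt_exp_smul_const (𝔸 := Mat n) (-(z • α.delaunay l)) s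
      refine (HasDerivAt.mul (𝔸 := Mat n) h2 h1).congr_deriv ?_
      have h3 := h.delaunay_mul l hsU
      -- With `D E = E α(∂_u)`, the `λ⁻¹`-parts of `α(z)` and `z D` cancel.
      have h4 : B l s = α.eval l (s • z) z - z • α.eval l (s • z) 1 := by
        simp only [B, Q, R, hc, Form.eval, Form.coeffDzbar, map_one]
        module
      rw [h4, mul_sub, mul_smul_comm, mul_assoc _ _ (α.eval l (s • z) 1), ← h3]
      simp only [mul_neg, mul_smul_comm, neg_mul, smul_mul_assoc, mul_assoc]
      exact neg_add_eq_sub _ _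
    have hlim := tendstoUniformly_eulerProd (𝔸 := Mat n) (norm_one_le n)
      (B := fun (l : Circle) => B l) (M := M) hY
      (fun l => by
        simp only [zero_smul, h.init, OneMemClass.coe_one, matC_one, mul_one]
        exact exp_zero)
      (fun l => hBM l (hn l))
      (fun ε hε => by
        obtain ⟨δ, hδ, h'⟩ := hEq ε hε
        refine ⟨δ, hδ, fun l s hs t ht hst => ?_⟩
        simpa using h' 0 l (by simp) (hn l) s hs t ht hst)
    have hV : ∀ l, S.mat ((e l)⁻¹ * S.incl (E l z))
        = exp ((1 : ℝ) • (-(z • α.delaunay l))) * matC (E l ((1 : ℝ) • z) : GL (Fin n) ℝ) := by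
      intro l
      rw [one_smul, one_smul, mat_mul, mat_incl]
      congr 1
      calc S.mat (e l)⁻¹ = S.mat (e l)⁻¹ * (exp (z • α.delaunay l) * exp (-(z • α.delaunay l))) := by
            rw [mat_exp_mul_exp_neg, mul_one]
        _ = _ := by rw [← mul_assoc, ← he, mat_inv_mul, one_mul]
    simp only [hΓ, hV]
    exact hlim

/-! ### Gauge transformations independent of the loop parameter -/

/-- If the frames `E_1(z + w)` and `E_1(z)` differ by a map `κ` into `K`, up to a constant, then so
do `E_λ(z + w)` and `E_λ(z)`, with the same `κ`, for every `λ`. Applying `σ` gives the same relation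
at `λ = ζ`; comparing the two separates the parts of the Maurer-Cartan form, and shows that `κ`
gauges `α_λ(z)` to `α_λ(z + w)` for every `λ`. -/
theorem exists_loop_of_gauge (h : ExtendedFrame S U α E) {O : Set ℂ} (hO : IsOpen O)
    (hOc : IsPreconnected O) (hne : O.Nonempty) (hOU : O ⊆ U) {w : ℂ} (hw : ∀ z ∈ O, z + w ∈ U)
    {χ : S.G} {κ : ℂ → S.G} (hκ : ∀ z ∈ O, κ z ∈ S.K)
    (hE : ∀ z ∈ O, E 1 (z + w) = χ * E 1 z * κ z) :
    ∃ X : Circle → S.G, X 1 = χ ∧ Continuous X ∧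
      (∀ l, S.σ (S.incl (X l)) = S.incl (X (zeta k * l))) ∧
      ∀ l, ∀ z ∈ O, E l (z + w) = X l * E l z * κ z := by
  have hκσ : ∀ z ∈ O, S.σ (S.incl (κ z)) = S.incl (κ z) := fun z hz => S.K_le_fix _ (hκ z hz)
  have hshift : ∀ l, Solves (fun z v => α.eval l (z + w) v) O
      fun z => matC (E l (z + w) : GL (Fin n) ℝ) := fun l => (h.solves l).comp_add w hw
  have hκd : ∀ z ∈ O, DifferentiableAt ℝ (fun z => matC (κ z : GL (Fin n) ℝ)) z := by
    intro z hz
    have h1 : ∀ z ∈ O, matC (κ z : GL (Fin n) ℝ) = matC ((E 1 z : GL (Fin n) ℝ))⁻¹ *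
        (matC ((χ : GL (Fin n) ℝ))⁻¹ * matC (E 1 (z + w) : GL (Fin n) ℝ)) := by
      intro z hz
      rw [hE z hz, ← matC_mul, ← matC_mul]
      congr 1
      push_cast
      group
    have h2 := differentiableAt_matC_inv (h.solves 1 z (hOU hz)).1
    have h3 := DifferentiableAt.const_mul (𝔸 := Mat n) (hshift 1 z hz).1
      (matC ((χ : GL (Fin n) ℝ))⁻¹)
    have h4 := DifferentiableAt.mul (𝔸 := Mat n) h2 h3
    exact h4.congr_of_eventuallyEq (Filter.eventuallyEq_of_mem (hO.mem_nhds hz) h1)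
  have hprod : ∀ l, ∀ z ∈ O, HasFDerivAt (𝕜 := ℝ)
      (fun z => matC (E l z : GL (Fin n) ℝ) * matC (κ z : GL (Fin n) ℝ)) _ z := fun l z hz =>
    HasFDerivAt.mul' (𝔸 := Mat n) (h.solves l z (hOU hz)).1.hasFDerivAt (hκd z hz).hasFDerivAt
  have hprod' : ∀ l, ∀ z ∈ O, ∀ v,
      fderiv ℝ (fun z => matC (E l z : GL (Fin n) ℝ) * matC (κ z : GL (Fin n) ℝ)) z v
      = matC (E l z : GL (Fin n) ℝ) * (fderiv ℝ (fun z => matC (κ z : GL (Fin n) ℝ)) z v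
        + α.eval l z v * matC (κ z : GL (Fin n) ℝ)) := by
    intro l z hz v
    rw [(hprod l z hz).fderiv, mul_add, ← mul_assoc, ← (h.solves l z (hOU hz)).2 v]
    rfl
  -- The gauge relation at any parameter where the frames are related by `κ`.
  have hgauge : ∀ (l : Circle) (c : S.G), (∀ z ∈ O, E l (z + w) = c * E l z * κ z) →
      ∀ z ∈ O, ∀ v, matC (κ z : GL (Fin n) ℝ) * α.eval l (z + w) v
        = α.eval l z v * matC (κ z : GL (Fin n) ℝ)
          + fderiv ℝ (fun z => matC (κ z : GL (Fin n) ℝ)) z v := by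
    intro l c hc z hz v
    have h1 : HasFDerivAt (𝕜 := ℝ) (fun z => matC (c : GL (Fin n) ℝ) *
        (matC (E l z : GL (Fin n) ℝ) * matC (κ z : GL (Fin n) ℝ))) _ z :=
      HasFDerivAt.const_mul (𝔸 := Mat n) (hprod l z hz) _
    have h2 : HasFDerivAt (𝕜 := ℝ) (fun z => matC (E l (z + w) : GL (Fin n) ℝ)) _ z :=
      h1.congr_of_eventuallyEq (Filter.eventuallyEq_of_mem (hO.mem_nhds hz) fun y hy => by
        simp only [hc y hy, Subgroup.coe_mul, matC_mul, mul_assoc])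
    have h3 := (hshift l z hz).2 v
    rw [h2.fderiv] at h3
    change matC (c : GL (Fin n) ℝ) * (_ : ℂ →L[ℝ] Mat n) v = _ at h3
    rw [← (hprod l z hz).fderiv, hprod' l z hz v] at h3
    simp only [hc z hz, Subgroup.coe_mul, matC_mul, mul_assoc] at h3
    rw [← matC_mul_left_cancel (matC_mul_left_cancel h3), add_comm]
  have hgauge1 := hgauge 1 χ hE
  obtain ⟨χ', hχ'⟩ : ∃ χ' : S.G, S.incl χ' = S.σ (S.incl χ) := by
    obtain ⟨g, hg, hgc⟩ := S.σ_real (S.incl χ) ⟨χ, χ.2, rfl⟩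
    exact ⟨⟨g, hg⟩, Subtype.ext hgc⟩
  -- Since `σ` fixes `κ` and maps `E_1` to `E_ζ`, it carries the relation at `1` to one at `ζ`.
  have hgauge2 := hgauge (zeta k * 1) χ' fun z hz => by
    apply S.incl_injective
    rw [← h.sigma_incl (hw z hz), hE z hz]
    simp only [incl_mul, map_mul, h.sigma_incl (hOU hz), hκσ z hz, hχ']
  have hall : ∀ l, ∀ z ∈ O, ∀ v, matC (κ z : GL (Fin n) ℝ) * α.eval l (z + w) v
        = α.eval l z v * matC (κ z : GL (Fin n) ℝ)
          + fderiv ℝ (fun z => matC (κ z : GL (Fin n) ℝ)) z v := by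
    intro l z hz
    have hz1 : (zeta k : ℂ) ≠ 1 := zeta_ne_one S
    set A := matC (κ z : GL (Fin n) ℝ)
    have hpair : ∀ l : Circle, (∀ v, A * α.eval l (z + w) v
        = α.eval l z v * A + fderiv ℝ (fun z => matC (κ z : GL (Fin n) ℝ)) z v) →
        A * α.coeffDz l (z + w) = α.coeffDz l z * A + dz (fun z => matC (κ z : GL (Fin n) ℝ)) z ∧
        A * α.coeffDzbar l (z + w)
          = α.coeffDzbar l z * A + dzbar (fun z => matC (κ z : GL (Fin n) ℝ)) z := by
      intro l hl
      refine Form.eval_injective fun v => ?_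
      have := hl v
      rw [fderiv_eq_dz_dzbar, Form.eval, Form.eval, mul_add, add_mul, mul_smul_comm,
        mul_smul_comm, smul_mul_assoc, smul_mul_assoc] at this
      rw [this]
      module
    obtain ⟨a1, b1⟩ := hpair 1 (hgauge1 z hz)
    obtain ⟨a2, b2⟩ := hpair _ (hgauge2 z hz)
    simp only [Form.coeffDz, Form.coeffDzbar, Circle.coe_one, inv_one, one_smul, mul_one, mul_add,
      add_mul, mul_smul_comm, smul_mul_assoc] at a1 b1 a2 b2
    -- Differences of the relations at `1` and `ζ` isolate the `𝔪`-parts, as `ζ ≠ 1`.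
    have hm' : A * α.m' (z + w) = α.m' z * A := by
      have h1 : (1 - (zeta k : ℂ)⁻¹) • (A * α.m' (z + w)) = (1 - (zeta k : ℂ)⁻¹) • (α.m' z * A) := by
        have h2 := congrArg₂ (fun x y => x - y) a1 a2
        simp only [add_sub_add_right_eq_sub] at h2
        rw [sub_smul, sub_smul, one_smul, one_smul]
        exact h2
      refine smul_right_injective _ ?_ h1
      rw [Ne, sub_eq_zero, eq_comm, inv_eq_one]
      exact hz1
    have hm'' : A * α.m'' (z + w) = α.m'' z * A := by
      have h1 : (1 - (zeta k : ℂ)) • (A * α.m'' (z + w)) = (1 - (zeta k : ℂ)) • (α.m'' z * A) := by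
        have h2 := congrArg₂ (fun x y => x - y) b1 b2
        simp only [add_sub_add_right_eq_sub] at h2
        rw [sub_smul, sub_smul, one_smul, one_smul]
        exact h2
      refine smul_right_injective _ ?_ h1
      exact sub_ne_zero.2 hz1.symm
    have hk' : A * α.k' (z + w) = α.k' z * A + dz (fun z => matC (κ z : GL (Fin n) ℝ)) z := by
      rw [hm', add_assoc] at a1
      exact add_left_cancel a1
    have hk'' : A * α.k'' (z + w)
        = α.k'' z * A + dzbar (fun z => matC (κ z : GL (Fin n) ℝ)) z := by
      rw [hm'', add_assoc] at b1
      exact add_left_cancel b1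
    intro v
    rw [fderiv_eq_dz_dzbar]
    simp only [Form.eval, Form.coeffDz, Form.coeffDzbar, mul_add, add_mul, mul_smul_comm,
      smul_mul_assoc, hm', hm'', hk', hk'', smul_add]
    abel
  have hsol : ∀ l, Solves (fun z v => α.eval l (z + w) v) O
      fun z => matC ((E l z * κ z : S.G) : GL (Fin n) ℝ) := by
    intro l z hz
    simp only [Subgroup.coe_mul, matC_mul]
    refine ⟨(hprod l z hz).differentiableAt, fun v => ?_⟩
    rw [hprod' l z hz v, mul_assoc, hall l z hz, add_comm]
  obtain ⟨z₀, hz₀⟩ := hne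
  refine ⟨fun l => E l (z₀ + w) * (E l z₀ * κ z₀)⁻¹, ?_, ?_, fun l => ?_, fun l z hz => ?_⟩
  · simp only [hE z₀ hz₀]
    group
  · exact (h.continuous_param (hw z₀ hz₀)).mul
      (((h.continuous_param (hOU hz₀)).mul continuous_const).inv)
  · simp only [incl_mul, incl_inv, map_mul, map_inv, h.sigma_incl (hw z₀ hz₀),
      h.sigma_incl (hOU hz₀), hκσ z₀ hz₀]
  · have h1 := (hshift l).mul_const_on_preconnected hO hOc (hsol l) hz₀ hz
    rw [← matC_mul, ← matC_mul] at h1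
    have h2 : E l (z + w) * (E l z * κ z)⁻¹ = E l (z₀ + w) * (E l z₀ * κ z₀)⁻¹ :=
      Subtype.ext (matC_injective h1)
    simp only [← h2]
    group

/-! ### Unique continuation for symmetries -/

/-- If `c` in `G` fixes the values of `E_1` modulo `K` on an open set, then it fixes all of them. -/
theorem conj_mem_K_of_open (h : ExtendedFrame S U α E) {O : Set ℂ} (hO : IsOpen O)
    (hOc : IsPreconnected O) (hne : O.Nonempty) (hOU : O ⊆ U) {c : S.G}
    (hc : ∀ z ∈ O, (E 1 z)⁻¹ * c * E 1 z ∈ S.K) {z : ℂ} (hz : z ∈ U) :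
    (E 1 z)⁻¹ * c * E 1 z ∈ S.K := by
  obtain ⟨X, hX1, hXc, hXσ, hX⟩ := h.exists_loop_of_gauge hO hOc hne hOU (w := 0)
    (fun z hz => by rw [add_zero]; exact hOU hz) (χ := c⁻¹) (κ := fun z => (E 1 z)⁻¹ * c * E 1 z) hc
    (fun z _ => by rw [add_zero]; group)
  simp only [add_zero] at hX
  -- The loop `c(λ)` with `c(1) = c`, and its conjugates by the frames.
  let φ : ℂ → Circle → S.G := fun z l => (E l z)⁻¹ * (X l)⁻¹ * E l z
  -- On `O` the conjugates do not depend on `λ`, so `exp (-z D) c exp (z D)` extends to the disk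
  -- there, and then for every `z`.
  have hφO : ∀ z ∈ O, ∀ l, φ z l = (E 1 z)⁻¹ * c * E 1 z := by
    intro z hz l
    calc φ z l = (E l z)⁻¹ * (X l)⁻¹ * (X l * E l z * ((E 1 z)⁻¹ * c * E 1 z)) := by
          rw [← hX l z hz]
      _ = _ := by group
  have hXcC : Continuous fun l => S.mat (S.incl (X l)⁻¹) :=
    S.isEmbedding_mat.continuous.comp (S.continuous_incl.comp hXc.inv)
  have hφE : ∀ z l, S.mat (S.incl (E l z)) * S.mat (S.incl (φ z l))
      = S.mat (S.incl (X l)⁻¹) * S.mat (S.incl (E l z)) := by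
    intro z l
    rw [← mat_mul, ← mat_mul, ← incl_mul, ← incl_mul]
    congr 2
    simp only [φ]
    group
  have hexp : ∀ (z : ℂ) (l : Circle), exp (-(z • α.delaunay l)) * exp (z • α.delaunay l) = 1 :=
    fun z l => mat_exp_neg_mul_exp _
  have hdiscO : ∀ z ∈ O, HasDiscExtension fun l => exp (-(z • α.delaunay l))
      * S.mat (S.incl (X l)⁻¹) * exp (z • α.delaunay l) := by
    intro z hz
    obtain ⟨V, -, hV, hVE⟩ := h.exists_factorization (hOU hz)
    have h1 := ((hV.mul (extendsToDisc_const (hc z hz))).mul hV.inv).hasDiscExtension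
    convert h1 using 2 with l
    have h2 := hφE z l
    rw [hφO z hz l, hVE l] at h2
    calc exp (-(z • α.delaunay l)) * S.mat (S.incl (X l)⁻¹) * exp (z • α.delaunay l)
        = exp (-(z • α.delaunay l)) * (S.mat (S.incl (X l)⁻¹) * (exp (z • α.delaunay l)
            * S.mat (V l))) * S.mat (V l)⁻¹ := by
          simp only [mul_assoc, mat_mul_inv, mul_one]
      _ = _ := by
          rw [← h2]
          simp only [← mul_assoc, hexp, one_mul, mat_mul]
  have hdisc : ∀ z, HasDiscExtension fun l => exp (-(z • α.delaunay l))
      * S.mat (S.incl (X l)⁻¹) * exp (z • α.delaunay l) :=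
    hasDiscExtension_conj_exp (𝔸 := Mat n) α.continuous_delaunay hXcC hO hne hdiscO
  -- On all of `U` the conjugates extend to the disk and are real, hence are independent of `λ`.
  have hconst : ∀ z ∈ U, ∀ l, φ z l = φ z 1 := by
    intro z hz
    obtain ⟨V, -, hV, hVE⟩ := h.exists_factorization hz
    obtain ⟨Γ, hΓ, hΓφ⟩ := HasDiscExtension.mul (𝔸 := Mat n) (HasDiscExtension.mul (𝔸 := Mat n)
      hV.inv.hasDiscExtension (hdisc z)) hV.hasDiscExtension
    have h1 : ∀ l : Circle, Γ l = S.mat (S.incl (φ z l)) := by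
      intro l
      rw [hΓφ]
      have h2 := hφE z l
      rw [hVE l] at h2
      calc _ = S.mat (V l)⁻¹ * (exp (-(z • α.delaunay l)) * (S.mat (S.incl (X l)⁻¹)
            * (exp (z • α.delaunay l) * S.mat (V l)))) := by simp only [mul_assoc]
        _ = S.mat (V l)⁻¹ * ((exp (-(z • α.delaunay l)) * exp (z • α.delaunay l))
            * (S.mat (V l) * S.mat (S.incl (φ z l)))) := by
          rw [← h2]; simp only [mul_assoc]
        _ = _ := by rw [hexp, one_mul, ← mul_assoc, mat_inv_mul, one_mul]
    have h3 := eq_of_hasDiscExtension_of_real (γ := fun l => S.incl (φ z l)) hΓ h1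
      fun l => ⟨_, rfl⟩
    intro l
    exact S.incl_injective (S.mat_injective ((h3 l).trans (h3 1).symm))
  have hφ1 : ∀ z, φ z 1 = (E 1 z)⁻¹ * c * E 1 z := fun z => by simp only [φ, hX1, inv_inv]
  -- So they lie in the fixed group of `σ`, whose identity component is in `K`.
  have hfix : ∀ z ∈ U, S.σ (S.incl (φ z 1)) = S.incl (φ z 1) := by
    intro z hz
    conv_rhs => rw [← hconst z hz (zeta k * 1)]
    simp only [φ, incl_mul, incl_inv, map_mul, map_inv, h.sigma_incl hz, hXσ]
  obtain ⟨z₀, hz₀⟩ := hne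
  have hK₀ : φ z₀ 1 ∈ S.K := by rw [hφ1]; exact hc z₀ hz₀
  have hcont : ContinuousOn (fun z => φ z 1 * (φ z₀ 1)⁻¹) U := by
    have h1 : ContinuousOn (E 1) U :=
      S.isEmbedding_matC_G.continuousOn_iff.2 (h.smooth 1).continuousOn
    exact ((h1.inv.mul continuousOn_const).mul h1).mul continuousOn_const
  have himg := (h.convex.isPreconnected.image _ hcont).subset_connectedComponentIn
    (F := {g : S.G | S.σ (S.incl g) = S.incl g}) (x := 1) ⟨z₀, hOU hz₀, mul_inv_cancel _⟩ (by
      rintro _ ⟨y, hy, rfl⟩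
      change S.σ (S.incl _) = S.incl _
      rw [incl_mul, incl_inv, map_mul, map_inv, hfix y hy, hfix z₀ (hOU hz₀)])
  have h1 : φ z 1 * (φ z₀ 1)⁻¹ ∈ S.K := S.fix_zero_le_K (himg ⟨z, hz, rfl⟩)
  have h2 := mul_mem h1 hK₀
  rwa [inv_mul_cancel_right, hφ1] at h2

end ExtendedFrame

/-! ### Strips -/

theorem isOpen_strip (a b : EReal) : IsOpen (strip a b) := by
  have h : Continuous fun z : ℂ => (z.im : EReal) :=
    continuous_coe_real_ereal.comp Complex.continuous_im
  exact (isOpen_lt continuous_const h).inter (isOpen_lt h continuous_const)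

theorem strip_mem_of_le {a b : EReal} {z z₁ z₂ : ℂ} (h₁ : z₁ ∈ strip a b) (h₂ : z₂ ∈ strip a b)
    (h₁z : z₁.im ≤ z.im) (hz₂ : z.im ≤ z₂.im) : z ∈ strip a b :=
  ⟨h₁.1.trans_le (EReal.coe_le_coe_iff.2 h₁z), (EReal.coe_le_coe_iff.2 hz₂).trans_lt h₂.2⟩

theorem strip_mem_of_im_mem_uIcc {a b : EReal} {z z₁ z₂ : ℂ} (h₁ : z₁ ∈ strip a b)
    (h₂ : z₂ ∈ strip a b) (h : z.im ∈ Set.uIcc z₁.im z₂.im) : z ∈ strip a b := by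
  rcases Set.mem_uIcc.1 h with h | h
  · exact strip_mem_of_le h₁ h₂ h.1 h.2
  · exact strip_mem_of_le h₂ h₁ h.1 h.2

theorem convex_strip (a b : EReal) : Convex ℝ (strip a b) := by
  intro z hz y hy s t hs ht hst
  refine strip_mem_of_im_mem_uIcc hz hy ?_
  have := (convex_uIcc z.im y.im) (Set.left_mem_uIcc) (Set.right_mem_uIcc) hs ht hst
  simpa using this

theorem add_real_mem_strip {a b : EReal} {z : ℂ} (hz : z ∈ strip a b) (t : ℝ) :
    z + t ∈ strip a b := by
  simpa [strip] using hz

/-- Some translate of `z` by a multiple of `w` lies in a strip that meets its translate by `w`. -/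
theorem exists_sub_zsmul_mem_strip {a b : EReal} {w : ℂ} (hw : w.im ≠ 0)
    (hov : ∃ z ∈ strip a b, z + w ∈ strip a b) (z : ℂ) : ∃ m : ℤ, z - m * w ∈ strip a b := by
  obtain ⟨z₀, h₀, h₁⟩ := hov
  -- The chosen translate has its imaginary part between those of `z₀` and `z₀ + w`.
  refine ⟨⌊(z.im - z₀.im) / w.im⌋, strip_mem_of_im_mem_uIcc h₀ h₁ ?_⟩
  set t := (z.im - z₀.im) / w.im with ht
  have hz : (z - ⌊t⌋ * w).im = z₀.im + Int.fract t * w.im := by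
    have h2 : t * w.im = z.im - z₀.im := div_mul_cancel₀ _ hw
    simp only [Complex.sub_im, Complex.mul_im, Complex.intCast_re, Complex.intCast_im, zero_mul,
      add_zero, Int.fract]
    linarith
  rw [hz, Complex.add_im, Set.mem_uIcc]
  have hf0 := Int.fract_nonneg t
  have hf1 := (Int.fract_lt_one t).le
  rcases le_total 0 w.im with h | h
  · exact Or.inl ⟨by nlinarith, by nlinarith⟩
  · exact Or.inr ⟨by nlinarith, by nlinarith⟩

/-- The points between `z` and `z + j w` are in the strip, so the translation can be iterated. -/
theorem pow_smul_eq_of_translate {a b : EReal} {f : ℂ → S.Quot} {w : ℂ} {χ : S.G}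
    (hf : ∀ z ∈ strip a b, z + w ∈ strip a b → f (z + w) = χ • f z) (j : ℕ) {z : ℂ}
    (hz : z ∈ strip a b) (hzj : z + j * w ∈ strip a b) : f (z + j * w) = χ ^ j • f z := by
  induction j with
  | zero => simp
  | succ j ih =>
    have hmid : z + j * w ∈ strip a b := by
      refine strip_mem_of_im_mem_uIcc hz hzj ?_
      simp only [Complex.add_im, Complex.mul_im, Complex.natCast_re, Complex.natCast_im, zero_mul,
        add_zero, Set.mem_uIcc, Nat.cast_succ, Complex.add_re, Complex.one_re, Complex.one_im]
      have hj : (0 : ℝ) ≤ j := Nat.cast_nonneg j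
      rcases le_total 0 w.im with h | h
      · exact Or.inl ⟨by nlinarith, by nlinarith⟩
      · exact Or.inr ⟨by nlinarith, by nlinarith⟩
    have he : z + (j + 1 : ℕ) * w = z + j * w + w := by push_cast; ring
    rw [he] at hzj ⊢
    rw [hf _ hmid hzj, ih hmid, smul_smul, pow_succ']

/-- A map on a strip that is equivariant under the translation by `w`, as far as this makes sense,
extends to an equivariant map on the plane. -/
theorem exists_equivariant_extension {a b : EReal} {f : ℂ → S.Quot} {w : ℂ} (hw : w.im ≠ 0)
    (hov : ∃ z ∈ strip a b, z + w ∈ strip a b) {χ : S.G}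
    (hf : ∀ z ∈ strip a b, z + w ∈ strip a b → f (z + w) = χ • f z) :
    ∃ g : ℂ → S.Quot, (∀ z, g (z + w) = χ • g z) ∧
      ∀ z, ∀ m : ℤ, z - m * w ∈ strip a b → g z = χ ^ m • f (z - m * w) := by
  choose m hm using exists_sub_zsmul_mem_strip hw hov
  have hkey : ∀ (z : ℂ) (p q : ℤ), q ≤ p → z - p * w ∈ strip a b → z - q * w ∈ strip a b →
      χ ^ p • f (z - p * w) = χ ^ q • f (z - q * w) := by
    intro z p q hqp hp hq
    obtain ⟨j, rfl⟩ := Int.le.dest hqp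
    have he : z - q * w = z - (q + j : ℤ) * w + j * w := by push_cast; ring
    rw [he] at hq ⊢
    rw [pow_smul_eq_of_translate hf j hp hq, smul_smul, zpow_add, zpow_natCast]
  have hg : ∀ z, ∀ p : ℤ, z - p * w ∈ strip a b →
      χ ^ m z • f (z - m z * w) = χ ^ p • f (z - p * w) := by
    intro z p hp
    rcases le_total p (m z) with h | h
    · exact hkey z _ _ h (hm z) hp
    · exact (hkey z _ _ h hp (hm z)).symm
  refine ⟨fun z => χ ^ m z • f (z - m z * w), fun z => ?_, hg⟩
  have he : z + w - (m z + 1 : ℤ) * w = z - m z * w := by push_cast; ring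
  have h1 := hg (z + w) (m z + 1) (by rw [he]; exact hm z)
  rw [he] at h1
  change χ ^ m (z + w) • f (z + w - m (z + w) * w) = χ • χ ^ m z • f (z - m z * w)
  rw [h1, smul_smul, add_comm (m z), zpow_add, zpow_one]

/-! ### Primitive harmonicity of the associated family -/

theorem fderiv_shift (F : ℂ → Mat n) (c z : ℂ) :
    fderiv ℝ (fun z => F (z - c)) z = fderiv ℝ F (z - c) := by
  simp only [sub_eq_add_neg]
  exact fderiv_comp_add_right (𝕜 := ℝ) (f := F) (x := z) (-c)

theorem dz_shift (F : ℂ → Mat n) (c z : ℂ) : dz (fun z => F (z - c)) z = dz F (z - c) := by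
  rw [dz, dz, fderiv_shift]

theorem dzbar_shift (F : ℂ → Mat n) (c z : ℂ) :
    dzbar (fun z => F (z - c)) z = dzbar F (z - c) := by
  rw [dzbar, dzbar, fderiv_shift]

theorem mem_eigen_smul {j : ℤ} {X : Mat n} (h : X ∈ S.eigen j) (c : ℂ) : c • X ∈ S.eigen j := by
  obtain ⟨h1, h2⟩ := SigmaRel.smul (S := S) h c
  exact ⟨h1, by rw [h2, smul_comm]⟩

/-- The form `α_λ`, translated by `c`. -/
noncomputable def Form.member (α : Form n) (l : Circle) (c : ℂ) : Form n where
  m' z := (l : ℂ)⁻¹ • α.m' (z - c)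
  k' z := α.k' (z - c)
  m'' z := (l : ℂ) • α.m'' (z - c)
  k'' z := α.k'' (z - c)

theorem Form.coeffDz_member (α : Form n) (l μ : Circle) (c z : ℂ) :
    (α.member l c).coeffDz μ z = α.coeffDz (μ * l) (z - c) := by
  simp only [Form.coeffDz, Form.member, smul_smul, Circle.coe_mul, mul_inv]

theorem Form.coeffDzbar_member (α : Form n) (l μ : Circle) (c z : ℂ) :
    (α.member l c).coeffDzbar μ z = α.coeffDzbar (μ * l) (z - c) := by
  simp only [Form.coeffDzbar, Form.member, smul_smul, Circle.coe_mul]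

theorem Form.IsPrimitive.member {α : Form n} {U V : Set ℂ} (h : α.IsPrimitive S U) (l : Circle)
    {c : ℂ} (hV : ∀ z ∈ V, z - c ∈ U) : (α.member l c).IsPrimitive S V := by
  refine ⟨fun z hz => ?_, fun μ z hz => ?_⟩
  · obtain ⟨h1, h2, h3, h4⟩ := h.1 _ (hV z hz)
    exact ⟨mem_eigen_smul h1 _, h2, mem_eigen_smul h3 _, h4⟩
  · have := h.2 (μ * l) _ (hV z hz)
    have e1 : (α.member l c).coeffDz μ = fun z => α.coeffDz (μ * l) (z - c) :=
      funext (α.coeffDz_member l μ c)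
    have e2 : (α.member l c).coeffDzbar μ = fun z => α.coeffDzbar (μ * l) (z - c) :=
      funext (α.coeffDzbar_member l μ c)
    rw [e1, e2, dz_shift, dzbar_shift]
    exact this

/-- A map that agrees, up to translations and the action of `G`, with a member of the associated
family near each point is primitive harmonic. -/
theorem ExtendedFrame.isPrimitiveHarmonicOn {U : Set ℂ} {α : Form n} {E : Circle → ℂ → S.G}
    (h : ExtendedFrame S U α E) (l : Circle) {g : ℂ → S.Quot}
    (hg : ∀ z₀ : ℂ, ∃ c : ℂ, ∃ χ : S.G, z₀ - c ∈ U ∧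
      ∀ z, z - c ∈ U → g z = χ • (QuotientGroup.mk (E l (z - c)) : S.Quot)) :
    IsPrimitiveHarmonicOn S Set.univ g := by
  intro z₀ _
  obtain ⟨c, χ, hz₀, hgc⟩ := hg z₀
  have hsub : ContDiff ℝ ∞ fun z : ℂ => z - c := by fun_prop
  refine ⟨{z | z - c ∈ U}, h.isOpen.preimage hsub.continuous, hz₀, Set.subset_univ _,
    fun z => χ * E l (z - c), α.member l c, ⟨?_, fun z hz => (hgc z hz).symm⟩,
    h.primitive.member l fun z hz => hz, fun z hz => ?_⟩
  · have h1 : ContDiffOn ℝ ∞ (fun z => matC (E l (z - c) : GL (Fin n) ℝ)) {z | z - c ∈ U} :=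
      (h.smooth l).comp hsub.contDiffOn fun z hz => hz
    simp only [Subgroup.coe_mul, matC_mul]
    exact ContDiffOn.mul (𝔸 := Mat n) contDiffOn_const h1
  · have h1 := ((h.solves l).const_mul (matC (χ : GL (Fin n) ℝ))).comp_add (-c)
      (V' := {z | z - c ∈ U}) (fun z hz => by rw [← sub_eq_add_neg]; exact hz)
    simp only [← sub_eq_add_neg] at h1
    have h2 := dz_eq_of_fderiv (X := matC (χ : GL (Fin n) ℝ) * matC (E l (z - c) : GL (Fin n) ℝ)
      * α.coeffDz l (z - c)) (Y := matC (χ : GL (Fin n) ℝ) * matC (E l (z - c) : GL (Fin n) ℝ)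
      * α.coeffDzbar l (z - c)) (fun v => by
        rw [(h1 z hz).2 v]
        simp only [Form.eval, mul_add, mul_smul_comm])
    simp only [Subgroup.coe_mul, matC_mul, Form.coeffDz_member, Form.coeffDzbar_member, one_mul]
    exact h2

/-! ### The extended frame of a TE map -/

theorem Solves.congr {β : ℂ → ℂ → Mat n} {V : Set ℂ} (hV : IsOpen V) {F G : ℂ → Mat n}
    (h : Solves β V F) (hFG : ∀ z ∈ V, G z = F z) : Solves β V G := by
  intro z hz
  have h1 := (h z hz).1.hasFDerivAt.congr_of_eventuallyEq
    (Filter.eventuallyEq_of_mem (hV.mem_nhds hz) hFG)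
  exact ⟨h1.differentiableAt, fun v => by rw [h1.fderiv, (h z hz).2, hFG z hz]⟩

/-- The Maurer-Cartan form of a quasi-invariant frame is invariant under real translations; the
eigenspace decomposition shows that this holds for each of its parts. -/
theorem Form.IsPrimitive.eval_add_real {α : Form n} {U : Set ℂ} (h : α.IsPrimitive S U)
    (hU : IsOpen U) (hadd : ∀ z ∈ U, ∀ t : ℝ, z + t ∈ U) {F : ℂ → S.G}
    (hF : ContDiffOn ℝ ∞ (fun z => matC (F z : GL (Fin n) ℝ)) U)
    (hsol : α.IsSolution 1 U fun z => matC (F z : GL (Fin n) ℝ)) {R : ℝ → S.G}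
    (hR : ∀ z ∈ U, ∀ t : ℝ, F (z + t) = R t * F z) (l : Circle) {z : ℂ} (hz : z ∈ U) (t : ℝ)
    (v : ℂ) : α.eval l (z + t) v = α.eval l z v := by
  have h0 := hsol.solves hU hF
  have h1 : Solves (fun z v => α.eval 1 (z + t) v) U fun z => matC (F (z + t) : GL (Fin n) ℝ) :=
    h0.comp_add (t : ℂ) fun z hz => hadd z hz t
  have h2 : Solves (α.eval 1) U fun z => matC (F (z + t) : GL (Fin n) ℝ) :=
    (h0.const_mul (matC (R t : GL (Fin n) ℝ))).congr hU fun z hz => by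
      rw [hR z hz t, Subgroup.coe_mul, matC_mul]
  have h3 : ∀ v, α.eval 1 (z + t) v = α.eval 1 z v := fun v =>
    h1.form_unique h2 (fun z => matC_inv_mul _) hz v
  have hzt := hadd z hz t
  obtain ⟨a1, a2, a3, a4⟩ := h.1 z hz
  obtain ⟨b1, b2, b3, b4⟩ := h.1 _ hzt
  have e1 : α.coeffDz 1 (z + t) = α.coeffDz 1 z := by
    rw [Form.coeffDz_eq_eval, Form.coeffDz_eq_eval, h3, h3]
  have e2 : α.coeffDzbar 1 (z + t) = α.coeffDzbar 1 z := by
    rw [Form.coeffDzbar_eq_eval, Form.coeffDzbar_eq_eval, h3, h3]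
  simp only [Form.coeffDz, Form.coeffDzbar, Circle.coe_one, inv_one, one_smul] at e1 e2
  have hz1 : (zeta k : ℂ) ≠ 1 := zeta_ne_one S
  have hsplit : ∀ {j : ℤ} {m₁ m₂ k₁ k₂ : Mat n}, (zeta k : ℂ) ^ j ≠ 1 → m₁ ∈ S.eigen j →
      m₂ ∈ S.eigen j → k₁ ∈ S.eigen 0 → k₂ ∈ S.eigen 0 → m₁ + k₁ = m₂ + k₂ →
      m₁ = m₂ ∧ k₁ = k₂ := by
    intro j m₁ m₂ k₁ k₂ hj hm₁ hm₂ hk₁ hk₂ he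
    have hm := (sigmaRel_of_mem_eigen hm₁).sub (sigmaRel_of_mem_eigen hm₂)
    have hk := (sigmaRel_of_mem_eigen hk₂).sub (sigmaRel_of_mem_eigen hk₁)
    have hmk : m₁ - m₂ = k₂ - k₁ := by
      rw [sub_eq_sub_iff_add_eq_add, he, add_comm]
    rw [zpow_zero, one_smul, one_smul, ← hmk] at hk
    rw [← smul_sub] at hm
    have h0 := sub_eq_zero.1 (eq_zero_of_sigmaRel hj hm hk)
    exact ⟨h0, by rw [h0] at he; exact add_left_cancel he⟩
  obtain ⟨m1, k1⟩ := hsplit (by simpa using hz1) b1 a1 b2 a2 e1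
  obtain ⟨m2, k2⟩ := hsplit (by simpa using hz1) b3 a3 b4 a4 e2
  simp only [Form.eval, Form.coeffDz, Form.coeffDzbar, m1, k1, m2, k2]

/-! ### The center of `G` -/

theorem mul_comm_of_hasDerivAt {𝔸 : Type*} [NormedRing 𝔸] [NormedAlgebra ℝ 𝔸] {A : ℝ → 𝔸}
    {A' B : 𝔸} (hA : HasDerivAt A A' 0) (h : ∀ t, A t * B = B * A t) : A' * B = B * A' :=
  (hA.mul_const B).unique ((hA.const_mul B).congr_of_eventuallyEq (Eventually.of_forall h))

theorem hasDerivAt_exp_smul_zero {𝔸 : Type*} [NormedRing 𝔸] [NormedAlgebra ℝ 𝔸] [CompleteSpace 𝔸]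
    (X : 𝔸) : HasDerivAt (fun t : ℝ => exp (t • X)) X 0 := by
  simpa using hasDerivAt_exp_smul_const X (0 : ℝ)

theorem mul_comm_exp_of_mul_comm {A B : Mat n} (h : ∀ t : ℝ, exp (t • A) * B = B * exp (t • A)) :
    A * B = B * A :=
  mul_comm_of_hasDerivAt (𝔸 := Mat n) (hasDerivAt_exp_smul_zero (𝔸 := Mat n) A) h

/-- The Lie algebra of a semisimple group has trivial center. -/
theorem eq_zero_of_commute_lieG {Z : Matrix (Fin n) (Fin n) ℝ} (hZ : Z ∈ S.lieG)
    (h : ∀ Y ∈ S.lieG, Z * Y = Y * Z) : Z = 0 := by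
  have := S.semisimple
  have h1 : (⟨Z, hZ⟩ : S.lieG) ∈ LieAlgebra.center ℝ S.lieG := by
    rw [LieModule.mem_maxTrivSubmodule]
    rintro ⟨Y, hY⟩
    apply Subtype.ext
    change ⁅Y, Z⁆ = 0
    rw [LieRing.of_associative_ring_bracket, h Y hY, sub_self]
  rw [LieAlgebra.center_eq_bot, LieSubmodule.mem_bot] at h1
  exact congrArg Subtype.val h1

/-- If the commutators of `χ` with a one-parameter group `exp (t X)` in `G` are central in `G`, then
`χ` commutes with `X`: the derivative `χ⁻¹ X χ - X` of the commutators lies in the center of the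
Lie algebra. -/
theorem commute_of_commutator_mem_center {χ : S.G} {X : Matrix (Fin n) (Fin n) ℝ} {R : ℝ → S.G}
    (hR : ∀ t, ((R t : GL (Fin n) ℝ) : Matrix (Fin n) (Fin n) ℝ) = exp (t • X))
    (hc : ∀ t, (χ * R t)⁻¹ * (R t * χ) ∈ Subgroup.center S.G) (t : ℝ) : R t * χ = χ * R t := by
  have hX : X ∈ S.lieG := (S.mem_lieG X).2 fun t => ⟨R t, (R t).2, hR t⟩
  set u : GL (Fin n) ℝ := (χ : GL (Fin n) ℝ) with hu
  set c : Matrix (Fin n) (Fin n) ℝ := (u : Matrix (Fin n) (Fin n) ℝ) with hcdef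
  set ci : Matrix (Fin n) (Fin n) ℝ := ((u⁻¹ : GL (Fin n) ℝ) : Matrix (Fin n) (Fin n) ℝ) with hci
  have hcci : c * ci = 1 := by rw [hcdef, hci, ← Units.val_mul, mul_inv_cancel, Units.val_one]
  have hcic : ci * c = 1 := by rw [hcdef, hci, ← Units.val_mul, inv_mul_cancel, Units.val_one]
  have hconj : ∀ t : ℝ, exp (t • (ci * X * c)) = ci * exp (t • X) * c := by
    intro t
    rw [show t • (ci * X * c) = ci * (t • X) * c by
      rw [mul_smul_comm, smul_mul_assoc]]
    exact exp_units_conj' (𝔸 := Matrix (Fin n) (Fin n) ℝ) u (t • X)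
  have hX' : ci * X * c ∈ S.lieG := (S.mem_lieG _).2 fun t => by
    refine ⟨((χ⁻¹ * R t * χ : S.G) : GL (Fin n) ℝ), SetLike.coe_mem _, ?_⟩
    rw [hconj, ← hR]
    rfl
  have hRi : ∀ t, (((R t)⁻¹ : S.G) : GL (Fin n) ℝ).val = exp (t • -X) := by
    intro t
    have h1 : (((R t)⁻¹ : S.G) : GL (Fin n) ℝ).val * exp (t • X) = 1 := by
      rw [← hR, ← Units.val_mul, ← Subgroup.coe_mul, inv_mul_cancel]; rfl
    have h2 : exp (t • X) * exp (t • -X) = 1 := by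
      rw [smul_neg]; exact exp_mul_exp_neg (𝔸 := Matrix (Fin n) (Fin n) ℝ) _
    calc _ = (((R t)⁻¹ : S.G) : GL (Fin n) ℝ).val * (exp (t • X) * exp (t • -X)) := by
          rw [h2, mul_one]
      _ = _ := by rw [← mul_assoc, h1, one_mul]
  have hval : ∀ t, ((((χ * R t)⁻¹ * (R t * χ) : S.G) : GL (Fin n) ℝ) : Matrix (Fin n) (Fin n) ℝ)
      = exp (t • -X) * exp (t • (ci * X * c)) := by
    intro t
    have h1 : (χ * R t)⁻¹ * (R t * χ) = (R t)⁻¹ * (χ⁻¹ * R t * χ) := by group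
    rw [h1, hconj, ← hR, ← hRi]
    rfl
  have hd : HasDerivAt (fun t : ℝ => exp (t • -X) * exp (t • (ci * X * c)))
      (ci * X * c - X) 0 := by
    have h1 := HasDerivAt.mul (𝔸 := Matrix (Fin n) (Fin n) ℝ)
      (hasDerivAt_exp_smul_zero (𝔸 := Matrix (Fin n) (Fin n) ℝ) (-X))
      (hasDerivAt_exp_smul_zero (𝔸 := Matrix (Fin n) (Fin n) ℝ) (ci * X * c))
    refine h1.congr_deriv ?_
    have h2 : ∀ Y : Matrix (Fin n) (Fin n) ℝ, exp ((0 : ℝ) • Y) = 1 := fun Y => by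
      rw [zero_smul]; exact exp_zero
    have h3 : -X * (1 : Matrix (Fin n) (Fin n) ℝ) + 1 * (ci * X * c) = ci * X * c - X := by
      noncomm_ring
    refine Eq.trans ?_ h3
    exact congrArg₂ (fun A B => -X * A + B * (ci * X * c)) (h2 _) (h2 _)
  have hZ : ci * X * c - X = 0 := by
    refine eq_zero_of_commute_lieG (sub_mem hX' hX) fun Y hY => ?_
    have h1 : ∀ s : ℝ, exp (s • Y) * (ci * X * c - X) = (ci * X * c - X) * exp (s • Y) := by
      intro s
      obtain ⟨g, hg, hgY⟩ := (S.mem_lieG Y).1 hY s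
      refine (mul_comm_of_hasDerivAt (𝔸 := Matrix (Fin n) (Fin n) ℝ) hd fun t => ?_).symm
      have h2 := Subgroup.mem_center_iff.1 (hc t) ⟨g, hg⟩
      have h3 := congrArg (fun x : S.G => ((x : GL (Fin n) ℝ) : Matrix (Fin n) (Fin n) ℝ)) h2
      simp only [Subgroup.coe_mul, Units.val_mul] at h3
      rw [← hgY, ← hval]
      simp only [Subgroup.coe_mul, Units.val_mul]
      exact h3.symm
    exact (mul_comm_of_hasDerivAt (𝔸 := Matrix (Fin n) (Fin n) ℝ)
      (hasDerivAt_exp_smul_zero (𝔸 := Matrix (Fin n) (Fin n) ℝ) Y) h1).symm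
  have hXc : X * c = c * X := by
    have h1 : ci * X * c = X := sub_eq_zero.1 hZ
    calc X * c = c * (ci * X * c) := by rw [← mul_assoc, ← mul_assoc, hcci, one_mul]
      _ = c * X := by rw [h1]
  have h2 : ci * exp (t • X) * c = exp (t • X) := by
    rw [← hconj, mul_assoc, hXc, ← mul_assoc, hcic, one_mul]
  apply Subtype.ext
  apply Units.ext
  change ((R t : GL (Fin n) ℝ) : Matrix (Fin n) (Fin n) ℝ) * c = c * (R t : GL (Fin n) ℝ).val
  rw [hR]
  calc exp (t • X) * c = c * (ci * exp (t • X) * c) := by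
        rw [← mul_assoc, ← mul_assoc, hcci, one_mul]
    _ = c * exp (t • X) := by rw [h2]

theorem map_exp_algebraMap (X : Matrix (Fin n) (Fin n) ℝ) :
    (exp X).map (algebraMap ℝ ℂ) = exp (X.map (algebraMap ℝ ℂ)) := by
  let _ : NormedAlgebra ℚ (Matrix (Fin n) (Fin n) ℝ) := .restrictScalars ℚ ℝ _
  exact map_exp (𝔸 := Matrix (Fin n) (Fin n) ℝ) (𝔹 := Mat n) (algebraMap ℝ ℂ).mapMatrix
    (continuous_id.matrix_map Complex.continuous_ofReal) X

namespace ExtendedFrame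

variable {U : Set ℂ} {α : Form n} {E : Circle → ℂ → S.G}

/-- On the real axis the frame is a one-parameter group of real matrices. -/
theorem exists_real_generator (h : ExtendedFrame S U α E) (l : Circle) :
    ∃ X : Matrix (Fin n) (Fin n) ℝ,
      ∀ t : ℝ, ((E l t : GL (Fin n) ℝ) : Matrix (Fin n) (Fin n) ℝ) = exp (t • X) := by
  have hd : HasDerivAt (fun t : ℝ => matC (E l t : GL (Fin n) ℝ)) (α.delaunay l) 0 := by
    have h1 := hasDerivAt_exp_smul_zero (𝔸 := Mat n) (α.delaunay l)
    exact h1.congr_of_eventuallyEq (Eventually.of_forall fun t => h.real_eq_exp l t)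
  have him : ∀ i j, (α.delaunay l i j).im = 0 := by
    intro i j
    let p : Mat n →L[ℝ] ℝ := Complex.imCLM.comp
      ⟨Matrix.entryLinearMap ℝ ℂ i j, (continuous_apply j).comp (continuous_apply i)⟩
    have h1 : HasDerivAt (fun t : ℝ => p (matC (E l t : GL (Fin n) ℝ))) (p (α.delaunay l)) 0 :=
      p.hasFDerivAt.comp_hasDerivAt (0 : ℝ) hd
    have h2 : (fun t : ℝ => p (matC (E l t : GL (Fin n) ℝ))) = fun _ => 0 := by
      funext t
      change (matC (E l t : GL (Fin n) ℝ) i j).im = 0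
      rw [matC_eq_map]
      simp
    rw [h2] at h1
    exact h1.unique (hasDerivAt_const _ _)
  have hX : ((α.delaunay l).map Complex.re).map (algebraMap ℝ ℂ) = α.delaunay l := by
    ext i j
    apply Complex.ext <;> simp [him]
  refine ⟨(α.delaunay l).map Complex.re, fun t => ?_⟩
  refine Matrix.map_injective (algebraMap ℝ ℂ).injective ?_
  have h1 : (t • (α.delaunay l).map Complex.re).map (algebraMap ℝ ℂ) = t • α.delaunay l := by
    conv_rhs => rw [← hX]
    ext i j
    simp
  change matC (E l t : GL (Fin n) ℝ)
    = (exp (t • (α.delaunay l).map Complex.re)).map (algebraMap ℝ ℂ)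
  rw [map_exp_algebraMap, h1, h.real_eq_exp]

theorem isOneParameterGroup (h : ExtendedFrame S U α E) (l : Circle) :
    IsOneParameterGroup S fun t : ℝ => E l t := by
  refine ⟨S.isEmbedding_matC_G.continuous_iff.2 ?_, fun s t => ?_⟩
  · exact (h.smooth l).continuousOn.comp_continuous Complex.continuous_ofReal h.real_mem
  · have h1 := h.add_real_eq l (h.real_mem t) s
    change E l ((s + t : ℝ) : ℂ) = E l s * E l t
    rw [← h1, Complex.ofReal_add, add_comm]

/-! ### The monodromy -/

/-- The points of `U` that are mapped to `U` by the translation by `w`. -/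
def overlap (U : Set ℂ) (w : ℂ) : Set ℂ := {z | z ∈ U ∧ z + w ∈ U}

theorem isOpen_overlap (h : ExtendedFrame S U α E) (w : ℂ) : IsOpen (overlap U w) :=
  h.isOpen.inter (h.isOpen.preimage (continuous_id.add continuous_const))

theorem isPreconnected_overlap (h : ExtendedFrame S U α E) (w : ℂ) :
    IsPreconnected (overlap U w) := by
  exact (h.convex.inter (h.convex.translate_preimage_left w)).isPreconnected

theorem add_real_mem_overlap (h : ExtendedFrame S U α E) {w z : ℂ} (hz : z ∈ overlap U w) (t : ℝ) :
    z + t ∈ overlap U w :=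
  ⟨h.add_real z hz.1 t, by rw [add_right_comm]; exact h.add_real _ hz.2 t⟩

/-- A symmetry of the map at `λ = 1` produces the loops `b` and `χ`. -/
theorem exists_isMonodromyPair (h : ExtendedFrame S U α E) {w : ℂ}
    (hfull : ∀ c : S.G, (∀ z ∈ U, (E 1 z)⁻¹ * c * E 1 z ∈ S.K) → c ∈ Subgroup.center S.G)
    (hne : (overlap U w).Nonempty) {χ : S.G}
    (hχ : ∀ z ∈ overlap U w, (χ * E 1 z)⁻¹ * E 1 (z + w) ∈ S.K) :
    ∃ b X : Circle → S.GC, IsMonodromyPair S α.delaunay w b X := by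
  have hO := h.isOpen_overlap w
  have hOc := h.isPreconnected_overlap w
  have hOU : overlap U w ⊆ U := fun z hz => hz.1
  let κ : ℂ → S.G := fun z => (χ * E 1 z)⁻¹ * E 1 (z + w)
  have hE : ∀ z ∈ overlap U w, E 1 (z + w) = χ * E 1 z * κ z := fun z _ => by
    simp only [κ]; group
  have hshift : ∀ l, ∀ z ∈ overlap U w, ∀ t : ℝ, E l (z + t + w) = E l t * E l (z + w) := by
    intro l z hz t
    rw [add_right_comm, h.add_real_eq l hz.2]
  -- The commutator of `χ` with the translations fixes `f` on the overlap.
  have hcomm : ∀ t : ℝ, (χ * E 1 t)⁻¹ * (E 1 t * χ) ∈ Subgroup.center S.G := by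
    intro t
    refine hfull _ fun z hz => h.conj_mem_K_of_open hO hOc hne hOU (fun z hz => ?_) hz
    have h1 := hshift 1 z hz t
    have h2 := hE _ (h.add_real_mem_overlap hz t)
    rw [h.add_real_eq 1 hz.1] at h2
    rw [h2, hE z hz] at h1
    have h3 : (E 1 z)⁻¹ * ((χ * E 1 t)⁻¹ * (E 1 t * χ)) * E 1 z = κ (z + t) * (κ z)⁻¹ := by
      have h4 : κ (z + t) = (χ * (E 1 t * E 1 z))⁻¹ * (E 1 t * (χ * E 1 z * κ z)) := by
        rw [← h1]; group
      rw [h4]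
      group
    rw [h3]
    exact mul_mem (hχ _ (h.add_real_mem_overlap hz t)) (inv_mem (hχ z hz))
  obtain ⟨Y, hY⟩ := h.exists_real_generator 1
  have hχR : ∀ t : ℝ, E 1 t * χ = χ * E 1 t := fun t =>
    commute_of_commutator_mem_center hY hcomm t
  -- As `χ` commutes with the translations, `κ` is invariant under them, and then each `X l` commutes
  -- with the translations of the member `l`.
  have hκ : ∀ z ∈ overlap U w, ∀ t : ℝ, κ (z + t) = κ z := by
    intro z hz t
    simp only [κ]
    rw [hshift 1 z hz, h.add_real_eq 1 hz.1, ← mul_assoc χ, ← hχR]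
    group
  obtain ⟨X, -, hXc, hXσ, hX⟩ := h.exists_loop_of_gauge hO hOc hne hOU (fun z hz => hz.2) hχ hE
  obtain ⟨z, hz⟩ := hne
  have hXE : ∀ (l : Circle) (t : ℝ), E l t * X l = X l * E l t := by
    intro l t
    have h1 := hX l _ (h.add_real_mem_overlap hz t)
    change _ = X l * E l (z + t) * κ (z + t) at h1
    have h2 := hX l z hz
    change _ = X l * E l z * κ z at h2
    rw [hshift l z hz, h.add_real_eq l hz.1, hκ z hz, h2] at h1
    have h3 : E l t * X l * (E l z * κ z) = X l * E l t * (E l z * κ z) := by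
      simpa only [mul_assoc] using h1
    exact mul_right_cancel h3
  have hXD : ∀ l, Commute (S.mat (S.incl (X l))) (α.delaunay l) := by
    intro l
    refine (mul_comm_exp_of_mul_comm fun t => ?_).symm
    rw [← h.real_eq_exp, ← mat_incl, ← mat_mul, ← mat_mul, ← incl_mul, ← incl_mul, hXE]
  obtain ⟨e, heC, he⟩ := h.exists_expLoop w
  obtain ⟨ez, hezC, hez⟩ := h.exists_expLoop z
  have heX : ∀ l, e l * S.incl (X l) = S.incl (X l) * e l := fun l => S.mat_injective (by
    rw [mat_mul, mat_mul, he]; exact (((hXD l).smul_right w).exp_right).symm)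
  have hezX : ∀ l, ez l * S.incl (X l) = S.incl (X l) * ez l := fun l => S.mat_injective (by
    rw [mat_mul, mat_mul, hez]; exact (((hXD l).smul_right z).exp_right).symm)
  have hXC : (fun l => S.incl (X l)) ∈ LoopC S := ⟨S.continuous_incl.comp hXc, hXσ⟩
  refine ⟨fun l => (S.incl (X l))⁻¹ * e l, fun l => S.incl (X l),
    ⟨loopC_mul (loopC_inv hXC) heC, ?_⟩, fun l => ?_, ⟨hXC, fun l => ⟨X l, rfl⟩⟩, fun l => ?_⟩
  · -- `b = V κ W⁻¹`, where `V` and `W` are the `Λ⁺`-factors at `z` and `z + w`.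
    obtain ⟨V, -, hV, hVE⟩ := h.exists_factorization hz.1
    obtain ⟨W, -, hW, hWE⟩ := h.exists_factorization hz.2
    have hb : ∀ l, (S.incl (X l))⁻¹ * e l = V l * S.incl (κ z) * (W l)⁻¹ := by
      intro l
      have h1 : S.incl (E l z) = ez l * V l := S.mat_injective (by rw [hVE, mat_mul, hez])
      have h2 : S.incl (E l (z + w)) = ez l * e l * W l := S.mat_injective (by
        rw [hWE, mat_mul, mat_mul, hez, he, add_smul]
        congr 1
        exact Matrix.exp_add_of_commute _ _
          (((Commute.refl (α.delaunay l)).smul_left z).smul_right w))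
      have h3 : S.incl (E l (z + w)) = S.incl (X l) * S.incl (E l z) * S.incl (κ z) := by
        rw [← incl_mul, ← incl_mul, hX l z hz]
      rw [h1, h2, ← mul_assoc, ← hezX] at h3
      simp only [mul_assoc] at h3
      have h4 := mul_left_cancel h3
      rw [inv_mul_eq_iff_eq_mul, eq_comm]
      calc S.incl (X l) * (V l * S.incl (κ z) * (W l)⁻¹)
          = S.incl (X l) * (V l * S.incl (κ z)) * (W l)⁻¹ := by simp only [mul_assoc]
        _ = e l := by rw [← h4, mul_inv_cancel_right]
    simp only [hb]
    exact (hV.mul (extendsToDisc_const (hχ z hz))).mul hW.inv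
  · have h1 : Commute (S.mat (S.incl (X l))⁻¹) (α.delaunay l) := by
      have h2 := hXD l
      calc S.mat (S.incl (X l))⁻¹ * α.delaunay l
          = S.mat (S.incl (X l))⁻¹ * (α.delaunay l * S.mat (S.incl (X l)))
              * S.mat (S.incl (X l))⁻¹ := by
            rw [mul_assoc, mul_assoc, mat_mul_inv, mul_one]
        _ = α.delaunay l * S.mat (S.incl (X l))⁻¹ := by
            rw [← h2.eq, ← mul_assoc, mat_inv_mul, one_mul]
    rw [mat_mul, he]
    exact h1.mul_left ((Commute.refl (α.delaunay l)).smul_left w).exp_left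
  · rw [← he, ← mat_mul]
    congr 1
    rw [mul_inv_rev, inv_inv, mul_inv_cancel_left]

/-- A monodromy pair makes the translation by `w` a symmetry of every member of the family:
`E_λ(z)⁻¹ χ(λ)⁻¹ E_λ(z + w)` is real on the circle and extends to the disk, hence a constant
in `K`. -/
theorem translate_of_isMonodromyPair (h : ExtendedFrame S U α E) {w : ℂ} {b X : Circle → S.GC}
    (hbX : IsMonodromyPair S α.delaunay w b X) {z : ℂ} (hz : z ∈ overlap U w) (l : Circle) (χ : S.G)
    (hχ : S.incl χ = X l) : (χ * E l z)⁻¹ * E l (z + w) ∈ S.K := by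
  obtain ⟨⟨-, hb⟩, hbD, ⟨-, hXr⟩, hX⟩ := hbX
  choose x hx using hXr
  obtain ⟨e, -, he⟩ := h.exists_expLoop w
  obtain ⟨ez, -, hez⟩ := h.exists_expLoop z
  obtain ⟨V, -, hV, hVE⟩ := h.exists_factorization hz.1
  obtain ⟨W, -, hW, hWE⟩ := h.exists_factorization hz.2
  have hezb : ∀ l, ez l * b l = b l * ez l := fun l => S.mat_injective (by
    rw [mat_mul, mat_mul, hez]; exact (((hbD l).smul_right z).exp_right).symm)
  have heXb : ∀ l, e l = X l * b l := by
    intro l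
    rw [← mul_inv_eq_iff_eq_mul]
    exact S.mat_injective (by rw [mat_mul, he, hX])
  have hγ : ∀ l, (V l)⁻¹ * b l * W l = S.incl ((x l * E l z)⁻¹ * E l (z + w)) := by
    intro l
    have h1 : S.incl (E l z) = ez l * V l := S.mat_injective (by rw [hVE, mat_mul, hez])
    have h2 : S.incl (E l (z + w)) = e l * ez l * W l := S.mat_injective (by
      rw [hWE, mat_mul, mat_mul, hez, he, add_comm z w, add_smul]
      congr 1
      exact Matrix.exp_add_of_commute _ _
        (((Commute.refl (α.delaunay l)).smul_left w).smul_right z))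
    rw [incl_mul, incl_inv, incl_mul, h1, h2, hx, heXb, mul_assoc (X l), ← hezb]
    group
  obtain ⟨κ, hκ, hγκ⟩ := ((hV.inv.mul hb).mul hW).eq_const_of_real fun l => ⟨_, (hγ l).symm⟩
  have h1 : (x l * E l z)⁻¹ * E l (z + w) = κ := S.incl_injective (by rw [← hγ, ← hγκ])
  have h2 : χ = x l := S.incl_injective (by rw [hχ, hx])
  rw [h2, h1]
  exact hκ

end ExtendedFrame

/-! ### Symmetries of the associated family -/

/-- The data of an associated family amount to an extended frame whose member at `λ = 1` lifts `f`. -/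
theorem IsAssociatedFamily.exists_extendedFrame {a b : EReal} (ha : a < 0) (hb : 0 < b)
    {f : ℂ → S.Quot} {fam : Circle → ℂ → S.Quot} {D : Circle → Mat n}
    (h : IsAssociatedFamily S (strip a b) f fam D) :
    ∃ (α : Form n) (E : Circle → ℂ → S.G), ExtendedFrame S (strip a b) α E ∧
      (∀ z ∈ strip a b, f z = QuotientGroup.mk (E 1 z)) ∧
      (∀ l, ∀ z ∈ strip a b, fam l z = QuotientGroup.mk (E l z)) ∧ D = α.delaunay := by
  obtain ⟨F, α, E, ⟨hF, hF0, R, -, hR⟩, ⟨hα, hFα⟩, hE, hfam, hD⟩ := h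
  have h0 : (0 : ℂ) ∈ strip a b := by simpa [strip] using ⟨ha, hb⟩
  have hadd : ∀ z ∈ strip a b, ∀ t : ℝ, z + t ∈ strip a b := fun z hz t => add_real_mem_strip hz t
  have hEF : ExtendedFrame S (strip a b) α E :=
    { isOpen := isOpen_strip a b
      convex := convex_strip a b
      zero_mem := h0
      add_real := hadd
      primitive := hα
      smooth := fun l => (hE l).1
      solution := fun l => (hE l).2.1
      init := fun l => (hE l).2.2
      eval_add_real := fun l z hz t v =>
        hα.eval_add_real (isOpen_strip a b) hadd hF.1 hFα hR l hz t v }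
  refine ⟨α, E, hEF, fun z hz => ?_, hfam, funext hD⟩
  have h1 := (hFα.solves hEF.isOpen hF.1).mul_const_on_preconnected hEF.isOpen
    hEF.convex.isPreconnected (hEF.solves 1) h0 hz
  rw [← matC_mul, ← matC_mul, hF0, hEF.init] at h1
  have h2 : F z * (E 1 z)⁻¹ = 1 * (1 : S.G)⁻¹ := Subtype.ext (matC_injective h1)
  rw [inv_one, mul_one, mul_inv_eq_one] at h2
  rw [← h2, hF.2 z hz]

namespace ExtendedFrame

variable {U : Set ℂ} {α : Form n} {E : Circle → ℂ → S.G}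

theorem smul_mk_eq_iff (χ g g' : S.G) :
    (QuotientGroup.mk g' : S.Quot) = χ • (QuotientGroup.mk g : S.Quot) ↔
      (χ * g)⁻¹ * g' ∈ S.K := by
  rw [MulAction.Quotient.smul_mk, smul_eq_mul, eq_comm, QuotientGroup.eq]

/-- A symmetry of a member of the family on the overlap extends it to the plane. -/
theorem exists_extension {a b : EReal} (h : ExtendedFrame S (strip a b) α E) {w : ℂ}
    (hw : w.im ≠ 0) (hov : ∃ z ∈ strip a b, z + w ∈ strip a b) (l : Circle) {χ : S.G}
    (hχ : ∀ z ∈ overlap (strip a b) w, (χ * E l z)⁻¹ * E l (z + w) ∈ S.K) :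
    ∃ g : ℂ → S.Quot, (∀ z ∈ strip a b, g z = QuotientGroup.mk (E l z)) ∧
      IsPrimitiveHarmonicOn S Set.univ g ∧ (∀ z, g (z + w) = χ • g z) ∧
      ∀ z, ∀ m : ℤ, z - m * w ∈ strip a b →
        g z = χ ^ m • (QuotientGroup.mk (E l (z - m * w)) : S.Quot) := by
  obtain ⟨g, hg, hgm⟩ := exists_equivariant_extension (S := S)
    (f := fun z => QuotientGroup.mk (E l z)) hw hov (χ := χ)
    fun z hz hzw => (smul_mk_eq_iff χ _ _).2 (hχ z ⟨hz, hzw⟩)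
  refine ⟨g, fun z hz => ?_, h.isPrimitiveHarmonicOn l fun z₀ => ?_, hg, hgm⟩
  · have := hgm z 0 (by simpa using hz)
    simpa using this
  · obtain ⟨m, hm⟩ := exists_sub_zsmul_mem_strip hw hov z₀
    exact ⟨m * w, χ ^ m, hm, fun z hz => hgm z m hz⟩

end ExtendedFrame

end LoopTE

open LoopTE LoopTE.ExtendedFrame in
theorem mainTheorem7 {n k : ℕ} (S : LoopTE.KSymmetricSpace n k)
    (a b : EReal) (ha : a < 0) (hb : 0 < b)
    (f : ℂ → S.Quot)
    (hf : LoopTE.IsPrimitiveHarmonicOn S (LoopTE.strip a b) f)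
    (hTE : LoopTE.IsTE S (LoopTE.strip a b) f)
    (hfull : LoopTE.IsFull S (LoopTE.strip a b) f)
    (fam : Circle → ℂ → S.Quot) (D : Circle → LoopTE.Mat n)
    (hfam : LoopTE.IsAssociatedFamily S (LoopTE.strip a b) f fam D)
    (w : ℂ) (hw : w.im ≠ 0)
    (hoverlap : ∃ z ∈ LoopTE.strip a b, z + w ∈ LoopTE.strip a b) :
    ((∀ l : Circle, LoopTE.AdmitsTranslation S (LoopTE.strip a b) (fam l) w) ↔
      ∃ bp χ : Circle → S.GC, LoopTE.IsMonodromyPair S D w bp χ) ∧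
    (∀ bp χ : Circle → S.GC, LoopTE.IsMonodromyPair S D w bp χ →
      ∀ l₀ : Circle, (∃ c ∈ Subgroup.center S.G, S.incl c = χ l₀) →
        (∀ z ∈ LoopTE.strip a b, z + w ∈ LoopTE.strip a b → fam l₀ (z + w) = fam l₀ z) ∧
        ∃ g : LoopTE.Cylinder w → S.Quot,
          (∀ z ∈ LoopTE.strip a b, g (QuotientAddGroup.mk z) = fam l₀ z) ∧
          LoopTE.IsPrimitiveHarmonicCylinder S w g ∧
          ∃ R : ℝ → S.G, LoopTE.IsOneParameterGroup S R ∧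
            ∀ (p : LoopTE.Cylinder w) (t : ℝ),
              g (p + QuotientAddGroup.mk (t : ℂ)) = R t • g p) := by
  obtain ⟨α, E, h, hfE, hfamE, rfl⟩ := hfam.exists_extendedFrame ha hb
  refine ⟨⟨fun hadm => ?_, ?_⟩, ?_⟩
  · -- Only the symmetry at `λ = 1` is used.
    obtain ⟨g, hg, -, χ, hχ⟩ := hadm 1
    refine h.exists_isMonodromyPair (χ := χ) (fun c hc => ?_) ?_ fun z hz => ?_
    · have h1 : c ∈ {R : S.G | ∀ z ∈ strip a b, R • f z = f z} := fun z hz => by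
        rw [hfE z hz, eq_comm, smul_mk_eq_iff]
        have := inv_mem (hc z hz)
        simpa [mul_assoc] using this
      rw [hfull] at h1
      exact h1
    · obtain ⟨z, hz⟩ := hoverlap
      exact ⟨z, hz⟩
    · rw [← smul_mk_eq_iff, ← hfamE 1 _ hz.2, ← hfamE 1 _ hz.1, ← hg hz.1, ← hg hz.2, hχ]
  · rintro ⟨bp, X, hbX⟩ l
    obtain ⟨χ, hχ⟩ := hbX.2.2.1.2 l
    obtain ⟨g, hgE, hgh, hgw, -⟩ := h.exists_extension hw hoverlap l fun z hz =>
      h.translate_of_isMonodromyPair hbX hz l χ hχ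
    exact ⟨g, fun z hz => by rw [hgE z hz, hfamE l z hz], hgh, χ, hgw⟩
  · rintro bp X hbX l ⟨c, hc, hcX⟩
    have hcK : c ∈ S.K := S.center_le_K hc
    -- A central element lies in `K`, so it acts trivially on `G/K`.
    have hK : ∀ z ∈ overlap (strip a b) w, (1 * E l z)⁻¹ * E l (z + w) ∈ S.K := by
      intro z hz
      have h1 := mul_mem hcK (h.translate_of_isMonodromyPair hbX hz l c hcX)
      have h2 : (1 * E l z)⁻¹ * E l (z + w) = c * ((c * E l z)⁻¹ * E l (z + w)) := by
        rw [← Subgroup.mem_center_iff.1 hc (E l z)]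
        group
      rwa [h2]
    obtain ⟨g, hgE, hgh, hgw, hgm⟩ := h.exists_extension hw hoverlap l hK
    simp only [one_smul] at hgw
    -- `w`-periodicity, which lets `g` descend to the cylinder.
    have hgz : ∀ z, ∀ m : ℤ, g (z + m * w) = g z := by
      intro z m
      obtain ⟨p, hp⟩ := exists_sub_zsmul_mem_strip hw hoverlap z
      have he : z + m * w - (p + m : ℤ) * w = z - p * w := by push_cast; ring
      rw [hgm z p hp, hgm (z + m * w) (p + m) (by rw [he]; exact hp), he, one_zpow, one_zpow]
    refine ⟨fun z hz hzw => ?_, ?_⟩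
    · rw [hfamE l _ hz, hfamE l _ hzw, ← hgE _ hz, ← hgE _ hzw, hgw]
    let G : Cylinder w → S.Quot := Quotient.lift g (by
      intro x y hxy
      obtain ⟨m, hm⟩ := AddSubgroup.mem_zmultiples_iff.1 (QuotientAddGroup.leftRel_apply.1 hxy)
      have hy : y = x + m * w := by
        rw [zsmul_eq_mul] at hm
        rw [hm]; ring
      rw [hy, hgz])
    have hG : ∀ z : ℂ, G (QuotientAddGroup.mk z) = g z := fun z => rfl
    refine ⟨G, fun z hz => by rw [hG, hgE z hz, hfamE l z hz], hgh, fun t => E l t,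
      h.isOneParameterGroup l, fun p t => ?_⟩
    induction p using QuotientAddGroup.induction_on with
    | H z =>
      rw [← QuotientAddGroup.mk_add, hG, hG]
      obtain ⟨m, hm⟩ := exists_sub_zsmul_mem_strip hw hoverlap z
      have he : z + t - m * w = z - m * w + t := by ring
      rw [hgm z m hm, hgm (z + t) m (by rw [he]; exact h.add_real _ hm t), he,
        h.add_real_eq l hm, one_zpow, one_smul, one_smul]
      rfl
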